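/- Let $\alpha\in\mathbb R$ be irrational, let $(q_k)_{k\ge 0}$ be the denominators of the convergents of its continued fraction expansion (so $q_0=1$), and let $\|t\|$ denote the distance of a real number $t$ to the nearest integer. Let $T x = x+\alpha$ be the corresponding rotation of the circle $\mathbb T=\mathbb R/\mathbb Z$, identified with $[0,1)$ and endowed with Lebesgue measure $\mu$, let $c>0$, and let $f:\mathbb T\to(0,\infty)$ be the roof function $f(x)=x+c$ for $x\in[0,1)$. Let $T^f=(T^f_t)_{t\in\mathbb R}$ be the special flow over $T$ under $f$: it acts on $X^f=\{(x,r)\in\mathbb T\times\mathbb R:\ 0\le r<f(x)\}$, endowed with the restriction $\mu^f$ of $\mu\otimes\lambda_{\mathbb R}$ ($\lambda_{\mathbb R}$ being Lebesgue measure on $\mathbb R$), by $$T^f_t(x,r)=(T^nx,\ r+t-f^{(n)}(x)),$$ where $n\in\mathbb Z$ is the unique integer with $f^{(n)}(x)\le r+t<f^{(n+1)}(x)$, and $f^{(n)}(x)=\sum_{j=0}^{n-1}f(T^jx)$ for $n\ge 0$, $f^{(n)}(x)=-\sum_{j=n}^{-1}f(T^{j}x)$ for $n<0$. Suppose that there are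 $\kappa\in(1/2,1)$ and a strictly increasing sequence of indices $(k_n)$ such that $$q_{k_n+1}\,\|q_{k_n}\alpha\|\longrightarrow\kappa\qquad(n\to\infty).$$ Then the flow $T^f$ is not isomorphic to its inverse: there is no $\mu^f$-preserving map $S:X^f\to X^f$, invertible modulo null sets, such that for each $t\in\mathbb R$, $S\circ T^f_t=T^f_{-t}\circ S$ holds $\mu^f$-almost everywhere. -/

import Mathlib

open MeasureTheory Filter Topology

noncomputable section

/-- The cocycle `f^(k)`, `k ∈ ℤ`, generated by `f` over the automorphism `T`:
`f x + f (T x) + ⋯ + f (T^(k-1) x)` for `k > 0`, `0` for `k = 0`, and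
`-(f (T^k x) + ⋯ + f (T^(-1) x))` for `k < 0`. -/
def cocycleSum {X : Type*} (T : Equiv.Perm X) (f : X → ℝ) : ℤ → X → ℝ
  | Int.ofNat k, x => ∑ j ∈ Finset.range k, f ((T ^ (j : ℤ)) x)
  | Int.negSucc k, x => -∑ j ∈ Finset.range (k + 1), f ((T ^ (-((j : ℤ) + 1))) x)

theorem cocycleSum_succ {X : Type*} (T : Equiv.Perm X) (f : X → ℝ) (n : ℤ) (x : X) :
    cocycleSum T f (n + 1) x = cocycleSum T f n x + f ((T ^ n) x) := by
  cases n with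
  | ofNat k =>
    change (∑ j ∈ Finset.range (k + 1), f ((T ^ (j : ℤ)) x)) = _
    rw [Finset.sum_range_succ]
    rfl
  | negSucc k =>
    cases k with
    | zero =>
      have h : cocycleSum T f (Int.negSucc 0 + 1) x = 0 := Finset.sum_range_zero _
      rw [h]
      simp [cocycleSum]
    | succ k =>
      have h : Int.negSucc (k + 1) + 1 = Int.negSucc k := by omega
      rw [h]
      simp only [cocycleSum]
      rw [Finset.sum_range_succ _ (k + 1)]
      have h' : Int.negSucc (k + 1) = -(((k + 1 : ℕ) : ℤ) + 1) := by omega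
      rw [h']
      ring

/-- The space `X^f = {(x, r) : 0 ≤ r < f x}` under the graph of the roof function `f`. -/
def SpecialSpace {X : Type*} (f : X → ℝ) : Type _ :=
  {p : X × ℝ // 0 ≤ p.2 ∧ p.2 < f p.1}

/-- The restriction to `X^f` of the product σ-algebra on `X × ℝ`. -/
instance {X : Type*} [MeasurableSpace X] (f : X → ℝ) : MeasurableSpace (SpecialSpace f) :=
  Subtype.instMeasurableSpace

/-- The measure `μ^f`: the restriction to `X^f` of the product of `μ` with Lebesgue measure. -/
def specialMeasure {X : Type*} [MeasurableSpace X] (μ : Measure X) (f : X → ℝ) :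
    Measure (SpecialSpace f) :=
  Measure.comap (fun p : SpecialSpace f => p.1) (μ.prod volume)

open scoped Classical in
/-- The special flow `T^f_t (x, r) = (T^n x, r + t - f^(n) x)`, where `n ∈ ℤ` satisfies
`f^(n) x ≤ r + t < f^(n+1) x`. Such an `n` exists, and is unique, as soon as `f` is bounded below
by a positive constant; a point without such an `n` is left fixed. -/
def specialFlow {X : Type*} (T : Equiv.Perm X) (f : X → ℝ) (t : ℝ) (p : SpecialSpace f) :
    SpecialSpace f :=
  if h : ∃ n : ℤ, cocycleSum T f n p.1.1 ≤ p.1.2 + t ∧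
      p.1.2 + t < cocycleSum T f (n + 1) p.1.1 then
    ⟨((T ^ h.choose) p.1.1, p.1.2 + t - cocycleSum T f h.choose p.1.1),
      sub_nonneg.mpr h.choose_spec.1,
      sub_lt_iff_lt_add'.mpr (h.choose_spec.2.trans_eq (cocycleSum_succ T f _ _))⟩
  else p

/-- Measure-theoretic isomorphism of two flows `(S_t)` on `(X, μ)` and `(R_t)` on `(Y, ν)`:
a measure-preserving map, invertible modulo null sets, which intertwines `S_t` and `R_t`
almost everywhere, for each `t ∈ ℝ`. -/
def FlowsIsomorphic {X Y : Type*} [MeasurableSpace X] [MeasurableSpace Y]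
    (μ : Measure X) (S : ℝ → X → X) (ν : Measure Y) (R : ℝ → Y → Y) : Prop :=
  ∃ (φ : X → Y) (ψ : Y → X), MeasurePreserving φ μ ν ∧ MeasurePreserving ψ ν μ ∧
    (∀ᵐ x ∂μ, ψ (φ x) = x) ∧ (∀ᵐ y ∂ν, φ (ψ y) = y) ∧
    ∀ t : ℝ, ∀ᵐ x ∂μ, φ (S t x) = R t (φ x)

/-- A flow is isomorphic to its inverse `t ↦ S_{-t}`. -/
def IsomorphicToInverse {X : Type*} [MeasurableSpace X] (μ : Measure X) (S : ℝ → X → X) : Prop :=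
  FlowsIsomorphic μ S μ (fun t => S (-t))

/-- The rotation `x ↦ x + α` of the circle `ℝ / ℤ`. -/
def circleRotation (α : ℝ) : Equiv.Perm UnitAddCircle :=
  Equiv.addRight (α : UnitAddCircle)

/-- The roof function `x ↦ x + c` on the circle identified with `[0, 1)`. -/
def affineRoof (c : ℝ) (x : UnitAddCircle) : ℝ :=
  (AddCircle.equivIco (1 : ℝ) 0 x : ℝ) + c

/-- The distance of a real number to the nearest integer. -/
def distNearestInt (x : ℝ) : ℝ := |x - round x|

/-- The denominator `q_k` of the `k`-th convergent of the continued fraction of `α`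
(so `q_0 = 1`, `q_1 = a_1`). -/
def cfDenom (α : ℝ) (k : ℕ) : ℝ := (GenContFract.of α).dens k

end

/-! The obstruction to reversibility is a third moment, detected by triple correlations `∫ F ·
G(T_s) · H(T_w)`. A measure-preserving `φ` reversing the flow turns the correlation of `F ∘ φ, G ∘
φ, H ∘ φ` at times `(s, w)` into that of `H, G, F` at `(w - s, w)` (`tripleCorr_comp_of_reversing`);
the pair `(s, 2s)` is fixed by this change of times.

Let `q` be a convergent denominator and `S = sawSum α q`, the centred Birkhoff sum of the roof. The
mean of the roof is `c + 1/2`, so the flow at time `q(c + 1/2)` sends `(x, r)` to `(x + qα, r - S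
x)`, where `|S| ≤ 4` by Denjoy–Koksma and `qα → 0`. Moreover `S(x + α) - S x → 0` almost everywhere,
and by Fourier analysis such functions become independent of the base point. Hence, with `U y = S(y
+ qα)`, the correlations at `(q(c + 1/2), 2q(c + 1/2))` are asymptotic to the averages over `y` of
the correlations at the bounded times `(-S y, -(S y + U y))` (`tendsto_tripleCorr_sub_integral`).
Applied on both sides of the reversal identity, this shows that the averages for `(S, S + U)` and
`(U, S + U)` agree in the limit. Test functions supported on a flow box make the averaged function a
cubic polynomial, and the difference reduces to a nonzero multiple of `∫ (U - S)³`, which therefore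
tends to `0`.

That moment is explicit: by the best approximation property, `U - S` is, up to sign, `b - N` with `b
= q‖qα‖` and `N` a `{0, 1}`-valued function of mean `b`, so its third moment is `± b(1 - b)(2b - 1)`
(`integral_sawSum_sub_pow_three`). Thus reversibility forces every limit point of `b_k = q_k‖q_kα‖`
into `{0, 1/2, 1}`.

Finally `q_{k+1}‖q_kα‖ + q_k‖q_{k+1}α‖ = 1` gives `b_k b_{k+1} → κ(1 - κ)` along the given indices.
This limit lies in `(0, 1/4)`, and limit points of the first factor are at most `κ < 1`; so the
first factor tends to `1/2` along a subsequence and the second to `2κ(1 - κ)`, which lies strictly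
between `0` and `1/2`: a contradiction. -/

theorem cocycleSum_zero {X : Type*} (T : Equiv.Perm X) (f : X → ℝ) (x : X) :
    cocycleSum T f 0 x = 0 :=
  Finset.sum_range_zero _

theorem cocycleSum_add {X : Type*} (T : Equiv.Perm X) (f : X → ℝ) (m n : ℤ) (x : X) :
    cocycleSum T f (m + n) x = cocycleSum T f m x + cocycleSum T f n ((T ^ m) x) := by
  induction n using Int.induction_on with
  | zero => simp [cocycleSum_zero]
  | succ n ih =>
    rw [← add_assoc, cocycleSum_succ, ih, cocycleSum_succ, add_assoc, ← Equiv.Perm.mul_apply,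
      ← zpow_add, add_comm (n : ℤ) m]
  | pred n ih =>
    have h1 := cocycleSum_succ T f (m + (-(n : ℤ) - 1)) x
    have h2 := cocycleSum_succ T f (-(n : ℤ) - 1) ((T ^ m) x)
    rw [show m + (-(n : ℤ) - 1) + 1 = m + -(n : ℤ) by ring, ih] at h1
    rw [show -(n : ℤ) - 1 + 1 = -(n : ℤ) by ring, ← Equiv.Perm.mul_apply, ← zpow_add,
      show -(n : ℤ) - 1 + m = m + (-(n : ℤ) - 1) by ring] at h2
    linarith

/-! ### Special flows: vertical coordinates, group law, measurability -/

section Flow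

variable {X : Type*} {T : Equiv.Perm X} {f : X → ℝ} {c : ℝ}

theorem cocycleSum_strictMono (hc : 0 < c) (hf : ∀ x, c ≤ f x) (x : X) :
    StrictMono fun n => cocycleSum T f n x := by
  refine strictMono_int_of_lt_succ fun n => ?_
  rw [cocycleSum_succ]
  linarith [hf ((T ^ n) x)]

theorem mul_le_cocycleSum (hf : ∀ x, c ≤ f x) (n : ℕ) (x : X) :
    n * c ≤ cocycleSum T f n x := by
  induction n with
  | zero => simp [cocycleSum_zero]
  | succ n ih =>
    push_cast
    rw [cocycleSum_succ]
    linarith [hf ((T ^ (n : ℤ)) x)]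

theorem cocycleSum_neg_le (hf : ∀ x, c ≤ f x) (n : ℕ) (x : X) :
    cocycleSum T f (-n) x ≤ -(n * c) := by
  have h := cocycleSum_add T f (-(n : ℤ)) n x
  rw [neg_add_cancel, cocycleSum_zero] at h
  linarith [mul_le_cocycleSum (T := T) hf n ((T ^ (-(n : ℤ))) x)]

/-- As `f ≥ c > 0`, the cocycle grows at least linearly in both directions, so there is a greatest
index whose value does not exceed `r`. -/
theorem exists_cocycleSum_le_lt (hc : 0 < c) (hf : ∀ x, c ≤ f x) (x : X) (r : ℝ) :
    ∃ n : ℤ, cocycleSum T f n x ≤ r ∧ r < cocycleSum T f (n + 1) x := by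
  have hmono := cocycleSum_strictMono (T := T) hc hf x
  obtain ⟨N, hN⟩ := exists_nat_gt (|r| / c)
  have hN' : |r| < N * c := by rwa [div_lt_iff₀ hc] at hN
  obtain ⟨n, hn, hmax⟩ := Int.exists_greatest_of_bdd
    (P := fun n => cocycleSum T f n x ≤ r)
    ⟨N, fun z hz => by
      by_contra! h
      have := hmono h
      have := mul_le_cocycleSum (T := T) hf N x
      have := le_abs_self r
      simp only at *
      linarith⟩
    ⟨-N, by
      have := cocycleSum_neg_le (T := T) hf N x
      have := neg_abs_le r
      linarith⟩
  refine ⟨n, hn, ?_⟩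
  by_contra! h
  have := hmax _ h
  omega

theorem specialFlow_val (hc : 0 < c) (hf : ∀ x, c ≤ f x) {t : ℝ} {p : SpecialSpace f} {n : ℤ}
    (h1 : cocycleSum T f n p.1.1 ≤ p.1.2 + t) (h2 : p.1.2 + t < cocycleSum T f (n + 1) p.1.1) :
    (specialFlow T f t p).1 = ((T ^ n) p.1.1, p.1.2 + t - cocycleSum T f n p.1.1) := by
  have h : ∃ n : ℤ, cocycleSum T f n p.1.1 ≤ p.1.2 + t ∧
      p.1.2 + t < cocycleSum T f (n + 1) p.1.1 := ⟨n, h1, h2⟩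
  have hmono := cocycleSum_strictMono (T := T) hc hf p.1.1
  have hn : h.choose = n := by
    have hs := h.choose_spec
    have a1 := hmono.lt_iff_lt.1 (hs.1.trans_lt h2)
    have a2 := hmono.lt_iff_lt.1 (h1.trans_lt hs.2)
    omega
  refine (congrArg Subtype.val (dif_pos h)).trans ?_
  change ((T ^ h.choose) p.1.1, p.1.2 + t - cocycleSum T f h.choose p.1.1) = _
  rw [hn]

/-- The projection of `X × ℝ` onto the special space which unwinds the vertical flow. -/
noncomputable def specialProj (T : Equiv.Perm X) (f : X → ℝ) (hf : ∀ x, 0 < f x) (z : X × ℝ) :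
    SpecialSpace f :=
  specialFlow T f z.2 ⟨(z.1, 0), le_rfl, hf z.1⟩

theorem specialProj_val (hf0 : ∀ x, 0 < f x) (hc : 0 < c) (hf : ∀ x, c ≤ f x) {x : X} {r : ℝ}
    {n : ℤ} (h1 : cocycleSum T f n x ≤ r) (h2 : r < cocycleSum T f (n + 1) x) :
    (specialProj T f hf0 (x, r)).1 = ((T ^ n) x, r - cocycleSum T f n x) := by
  have := specialFlow_val (T := T) (t := r) (p := ⟨(x, 0), le_rfl, hf0 x⟩) hc hf
    (by simpa using h1) (by simpa using h2)
  simpa [specialProj] using this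

theorem specialProj_coe (hf0 : ∀ x, 0 < f x) (hc : 0 < c) (hf : ∀ x, c ≤ f x)
    (p : SpecialSpace f) : specialProj T f hf0 p.1 = p := by
  apply Subtype.ext
  have h := p.2
  refine (specialProj_val (T := T) (n := 0) hf0 hc hf (x := p.1.1) (r := p.1.2) ?_ ?_).trans ?_
  · rw [cocycleSum_zero]; exact h.1
  · rw [cocycleSum_succ, cocycleSum_zero]; simpa using h.2
  · simp [cocycleSum_zero]

/-- The special space is the quotient of `X × ℝ` by the `ℤ`-action `(x, r) ↦ (T^n x, r - f^(n) x)`;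
by the cocycle identity the indices found for the two representatives differ by exactly `n`. -/
theorem specialProj_zpow (hf0 : ∀ x, 0 < f x) (hc : 0 < c) (hf : ∀ x, c ≤ f x) (x : X) (r : ℝ)
    (n : ℤ) :
    specialProj T f hf0 ((T ^ n) x, r - cocycleSum T f n x) = specialProj T f hf0 (x, r) := by
  obtain ⟨m, h1, h2⟩ := exists_cocycleSum_le_lt (T := T) hc hf ((T ^ n) x)
    (r - cocycleSum T f n x)
  have e1 := cocycleSum_add T f n m x
  have e2 := cocycleSum_add T f n (m + 1) x
  rw [← add_assoc] at e2
  apply Subtype.ext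
  rw [specialProj_val hf0 hc hf h1 h2, specialProj_val hf0 hc hf (x := x) (r := r) (n := n + m)
    (by linarith) (by linarith), e1, ← Equiv.Perm.mul_apply, ← zpow_add, add_comm m n, sub_sub]

theorem specialFlow_eq_specialProj (hf0 : ∀ x, 0 < f x) (hc : 0 < c) (hf : ∀ x, c ≤ f x) (t : ℝ)
    (p : SpecialSpace f) : specialFlow T f t p = specialProj T f hf0 (p.1.1, p.1.2 + t) := by
  obtain ⟨n, h1, h2⟩ := exists_cocycleSum_le_lt (T := T) hc hf p.1.1 (p.1.2 + t)
  exact Subtype.ext ((specialFlow_val hc hf h1 h2).trans (specialProj_val hf0 hc hf h1 h2).symm)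

/-- In the coordinates of `X × ℝ` the flow is vertical translation. All later computations with the
flow go through this identity. -/
theorem specialFlow_specialProj (hf0 : ∀ x, 0 < f x) (hc : 0 < c) (hf : ∀ x, c ≤ f x) (t : ℝ)
    (x : X) (r : ℝ) :
    specialFlow T f t (specialProj T f hf0 (x, r)) = specialProj T f hf0 (x, r + t) := by
  obtain ⟨n, h1, h2⟩ := exists_cocycleSum_le_lt (T := T) hc hf x r
  rw [specialFlow_eq_specialProj hf0 hc hf, specialProj_val hf0 hc hf h1 h2,
    ← specialProj_zpow hf0 hc hf x (r + t) n]
  congr 2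
  ring

theorem specialFlow_specialFlow (hc : 0 < c) (hf : ∀ x, c ≤ f x) (s t : ℝ) (p : SpecialSpace f) :
    specialFlow T f s (specialFlow T f t p) = specialFlow T f (t + s) p := by
  have hf0 : ∀ x, 0 < f x := fun x => hc.trans_le (hf x)
  rw [specialFlow_eq_specialProj hf0 hc hf t, specialFlow_specialProj hf0 hc hf,
    specialFlow_eq_specialProj hf0 hc hf, add_assoc]

theorem specialFlow_zero (hc : 0 < c) (hf : ∀ x, c ≤ f x) (p : SpecialSpace f) :
    specialFlow T f 0 p = p := by
  have hf0 : ∀ x, 0 < f x := fun x => hc.trans_le (hf x)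
  rw [specialFlow_eq_specialProj hf0 hc hf, add_zero]
  exact specialProj_coe hf0 hc hf p

theorem specialFlow_cocycleSum_shift (hf0 : ∀ x, 0 < f x) (hc : 0 < c) (hf : ∀ x, c ≤ f x)
    (x : X) (r : ℝ) (n : ℤ) :
    specialProj T f hf0 (x, r + cocycleSum T f n x) = specialProj T f hf0 ((T ^ n) x, r) := by
  rw [← specialProj_zpow hf0 hc hf x _ n, add_sub_cancel_right]

variable [MeasurableSpace X]

theorem measurable_zpow (hT : Measurable T) (hT' : Measurable T.symm) (n : ℤ) :
    Measurable (T ^ n : Equiv.Perm X) := by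
  induction n using Int.induction_on with
  | zero => exact measurable_id
  | succ n ih => rw [zpow_add_one]; exact ih.comp hT
  | pred n ih => rw [zpow_sub_one]; exact ih.comp hT'

theorem measurable_cocycleSum (hT : Measurable T) (hT' : Measurable T.symm) (hfm : Measurable f)
    (n : ℤ) : Measurable (cocycleSum T f n) := by
  cases n with
  | ofNat k =>
    exact Finset.measurable_fun_sum _ fun j _ => hfm.comp (measurable_zpow hT hT' _)
  | negSucc k =>
    exact (Finset.measurable_fun_sum _ fun j _ => hfm.comp (measurable_zpow hT hT' _)).neg

/-- The level sets of the index are cut out by two cocycle inequalities, hence measurable, and for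
each of the countably many indices the projection is an explicit measurable formula. -/
theorem measurable_specialProj (hf0 : ∀ x, 0 < f x) (hc : 0 < c) (hf : ∀ x, c ≤ f x)
    (hT : Measurable T) (hT' : Measurable T.symm) (hfm : Measurable f) :
    Measurable (specialProj T f hf0) := by
  choose n h1 h2 using exists_cocycleSum_le_lt (T := T) hc hf
  have hn : Measurable fun z : X × ℝ => n z.1 z.2 := by
    refine measurable_to_countable' fun k => ?_
    have : (fun z : X × ℝ => n z.1 z.2) ⁻¹' {k} =
        {z | cocycleSum T f k z.1 ≤ z.2} ∩ {z | z.2 < cocycleSum T f (k + 1) z.1} := by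
      ext z
      constructor
      · rintro rfl
        exact ⟨h1 _ _, h2 _ _⟩
      · rintro ⟨a1, a2⟩
        have hmono := cocycleSum_strictMono (T := T) hc hf z.1
        have b1 := hmono.lt_iff_lt.1 ((h1 z.1 z.2).trans_lt a2)
        have b2 := hmono.lt_iff_lt.1 (LE.le.trans_lt a1 (h2 z.1 z.2))
        change n z.1 z.2 = k
        omega
    rw [this]
    exact (measurableSet_le ((measurable_cocycleSum hT hT' hfm _).comp measurable_fst)
      measurable_snd).inter (measurableSet_lt measurable_snd
        ((measurable_cocycleSum hT hT' hfm _).comp measurable_fst))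
  refine Measurable.subtype_mk (f := fun z => (specialProj T f hf0 z).1) ?_
  have e : (fun z : X × ℝ => (specialProj T f hf0 z).1) =
      (fun y : (X × ℝ) × ℤ => ((T ^ y.2) y.1.1, y.1.2 - cocycleSum T f y.2 y.1.1)) ∘
        fun z => (z, n z.1 z.2) := by
    funext z
    exact specialProj_val hf0 hc hf (h1 z.1 z.2) (h2 z.1 z.2)
  rw [e]
  refine Measurable.comp ?_ (measurable_id.prodMk hn)
  refine measurable_from_prod_countable_left fun k => ?_
  exact ((measurable_zpow hT hT' k).comp measurable_fst).prodMk
    (measurable_snd.sub ((measurable_cocycleSum hT hT' hfm k).comp measurable_fst))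

theorem measurable_specialFlow (hc : 0 < c) (hf : ∀ x, c ≤ f x)
    (hT : Measurable T) (hT' : Measurable T.symm) (hfm : Measurable f) (t : ℝ) :
    Measurable (specialFlow T f t) := by
  have hf0 : ∀ x, 0 < f x := fun x => hc.trans_le (hf x)
  rw [funext fun p => specialFlow_eq_specialProj (T := T) hf0 hc hf t p]
  refine (measurable_specialProj hf0 hc hf hT hT' hfm).comp ?_
  exact (measurable_fst.comp measurable_subtype_coe).prodMk
    ((measurable_snd.comp measurable_subtype_coe).add_const t)

end Flow

/-! ### Integration on the special space and invariance of the measure -/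

section FlowIntegral

variable {X : Type*} [MeasurableSpace X] {T : Equiv.Perm X} {f : X → ℝ} {c C : ℝ}
  {μ : Measure X} [IsFiniteMeasure μ]

theorem measurableSet_underGraph (hfm : Measurable f) :
    MeasurableSet {z : X × ℝ | 0 ≤ z.2 ∧ z.2 < f z.1} :=
  (measurableSet_le measurable_const measurable_snd).inter
    (measurableSet_lt measurable_snd (hfm.comp measurable_fst))

/-- A bounded roof places the special space inside `X × [0, C]`, so that a product of finite
measures can be used for Fubini. -/
theorem integral_specialMeasure (hf0 : ∀ x, 0 < f x) (hc : 0 < c) (hf : ∀ x, c ≤ f x)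
    (hC : ∀ x, f x ≤ C) (hfm : Measurable f) (Θ : SpecialSpace f → ℝ) :
    ∫ p, Θ p ∂specialMeasure μ f =
      ∫ z, {z : X × ℝ | 0 ≤ z.2 ∧ z.2 < f z.1}.indicator (fun z => Θ (specialProj T f hf0 z)) z
        ∂μ.prod (volume.restrict (Set.Icc 0 C)) := by
  have hs := measurableSet_underGraph hfm
  have h1 : ∫ p, Θ p ∂specialMeasure μ f =
      ∫ z in {z : X × ℝ | 0 ≤ z.2 ∧ z.2 < f z.1}, Θ (specialProj T f hf0 z) ∂μ.prod volume := by
    rw [← integral_subtype_comap hs]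
    exact integral_congr_ae (Eventually.of_forall fun p =>
      congrArg Θ (specialProj_coe (T := T) hf0 hc hf p).symm)
  rw [h1, integral_indicator hs]
  congr 1
  have h2 : μ.prod (volume.restrict (Set.Icc 0 C)) =
      (μ.prod volume).restrict (Set.univ ×ˢ Set.Icc 0 C) := by
    rw [← Measure.prod_restrict, Measure.restrict_univ]
  rw [h2, Measure.restrict_restrict hs, Set.inter_eq_left.2]
  rintro z ⟨h0, hz⟩
  exact ⟨trivial, h0, hz.le.trans (hC _)⟩

theorem integrable_indicator_specialProj (hf0 : ∀ x, 0 < f x) (hc : 0 < c) (hf : ∀ x, c ≤ f x)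
    (hT : Measurable T) (hT' : Measurable T.symm) (hfm : Measurable f) {Θ : SpecialSpace f → ℝ}
    (hΘ : Measurable Θ) {B : ℝ} (hB : ∀ p, |Θ p| ≤ B) :
    Integrable ({z : X × ℝ | 0 ≤ z.2 ∧ z.2 < f z.1}.indicator
      fun z => Θ (specialProj T f hf0 z)) (μ.prod (volume.restrict (Set.Icc 0 C))) := by
  refine Integrable.indicator ?_ (measurableSet_underGraph hfm)
  exact Integrable.of_bound
    (hΘ.comp (measurable_specialProj hf0 hc hf hT hT' hfm)).aestronglyMeasurable B
    (Eventually.of_forall fun z => hB _)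

theorem integral_specialMeasure_eq_interval (hf0 : ∀ x, 0 < f x) (hc : 0 < c) (hf : ∀ x, c ≤ f x)
    (hC : ∀ x, f x ≤ C)
    (hT : Measurable T) (hT' : Measurable T.symm) (hfm : Measurable f) {Θ : SpecialSpace f → ℝ}
    (hΘ : Measurable Θ) {B : ℝ} (hB : ∀ p, |Θ p| ≤ B) :
    Integrable (fun x => ∫ r in (0 : ℝ)..f x, Θ (specialProj T f hf0 (x, r))) μ ∧
    ∫ p, Θ p ∂specialMeasure μ f =
      ∫ x, (∫ r in (0 : ℝ)..f x, Θ (specialProj T f hf0 (x, r))) ∂μ := by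
  have hint := integrable_indicator_specialProj (μ := μ) (C := C) hf0 hc hf hT hT' hfm hΘ hB
  have key : ∀ x, ∫ r in Set.Icc 0 C, {z : X × ℝ | 0 ≤ z.2 ∧ z.2 < f z.1}.indicator
      (fun z => Θ (specialProj T f hf0 z)) (x, r) =
      ∫ r in (0 : ℝ)..f x, Θ (specialProj T f hf0 (x, r)) := by
    intro x
    have e : (fun r => {z : X × ℝ | 0 ≤ z.2 ∧ z.2 < f z.1}.indicator
        (fun z => Θ (specialProj T f hf0 z)) (x, r)) =
        (Set.Ico 0 (f x)).indicator fun r => Θ (specialProj T f hf0 (x, r)) := by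
      funext r
      simp only [Set.indicator, Set.mem_ofPred_eq, Set.mem_Ico]
    rw [e, integral_indicator measurableSet_Ico, Measure.restrict_restrict measurableSet_Ico,
      Set.inter_eq_left.2, intervalIntegral.integral_of_le (hf0 x).le, integral_Ico_eq_integral_Ioo,
      integral_Ioc_eq_integral_Ioo]
    exact fun r hr => ⟨hr.1, hr.2.le.trans (hC x)⟩
  have h := hint.integral_prod_left
  simp only [key] at h
  refine ⟨h, ?_⟩
  rw [integral_specialMeasure (T := T) hf0 hc hf hC hfm, integral_prod _ hint]
  simp only [key]

/-- Let `g x` be the integral of `Θ` along the orbit of `(x, 0)` during time `t`. Moving the fibre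
`[0, f x)` up by `t` changes its integral by the coboundary `g (T x) - g x`, whose integral vanishes
because `T` preserves `μ`. -/
theorem integral_comp_specialFlow (hc : 0 < c) (hf : ∀ x, c ≤ f x) (hC : ∀ x, f x ≤ C)
    (hT : MeasurePreserving T μ μ) (hT' : Measurable T.symm) (hfm : Measurable f)
    {Θ : SpecialSpace f → ℝ} (hΘ : Measurable Θ) {B : ℝ} (hB : ∀ p, |Θ p| ≤ B) (t : ℝ) :
    ∫ p, Θ (specialFlow T f t p) ∂specialMeasure μ f = ∫ p, Θ p ∂specialMeasure μ f := by
  have hf0 : ∀ x, 0 < f x := fun x => hc.trans_le (hf x)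
  have hπ := hΘ.comp (measurable_specialProj (T := T) hf0 hc hf hT.measurable hT' hfm)
  have hΘt := hΘ.comp (measurable_specialFlow hc hf hT.measurable hT' hfm t)
  have hI0 := (integral_specialMeasure_eq_interval (μ := μ) hf0 hc hf hC hT.measurable hT' hfm
    hΘt fun p => hB _).2
  simp only [Function.comp_apply] at hI0
  rw [hI0]
  obtain ⟨hI, hI2⟩ := integral_specialMeasure_eq_interval (μ := μ) hf0 hc hf hC hT.measurable hT'
    hfm hΘ hB
  rw [hI2]
  set g : X → ℝ := fun x => ∫ r in (0 : ℝ)..t, Θ (specialProj T f hf0 (x, r)) with hg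
  have hgm : Measurable g := by
    have : ∀ s : Set ℝ, Measurable fun x => ∫ r in s, Θ (specialProj T f hf0 (x, r)) := fun s =>
      (StronglyMeasurable.integral_prod_right (f := fun x r => Θ (specialProj T f hf0 (x, r)))
        (ν := volume.restrict s) hπ.stronglyMeasurable).measurable
    exact (this _).sub (this _)
  have hgi : Integrable g μ := by
    refine Integrable.of_bound hgm.aestronglyMeasurable (B * |t - 0|) (Eventually.of_forall fun x => ?_)
    exact intervalIntegral.norm_integral_le_of_norm_le_const fun r _ => hB _
  have hii : ∀ x a b, IntervalIntegrable (fun r => Θ (specialProj T f hf0 (x, r))) volume a b := by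
    intro x a b
    exact (intervalIntegrable_const (c := B)).mono_fun'
      (hπ.comp measurable_prodMk_left).aestronglyMeasurable (Eventually.of_forall fun r => hB _)
  have key : ∀ x, ∫ r in (0 : ℝ)..f x, Θ (specialFlow T f t (specialProj T f hf0 (x, r))) =
      (∫ r in (0 : ℝ)..f x, Θ (specialProj T f hf0 (x, r))) + (g (T x) - g x) := by
    intro x
    have e1 : ∫ r in (0 : ℝ)..f x, Θ (specialFlow T f t (specialProj T f hf0 (x, r))) =
        ∫ r in (0 + t)..(f x + t), Θ (specialProj T f hf0 (x, r)) := by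
      rw [← intervalIntegral.integral_comp_add_right (fun r => Θ (specialProj T f hf0 (x, r)))]
      simp only [specialFlow_specialProj hf0 hc hf]
    -- The points `(T x, r)` and `(x, r + f x)` have the same projection.
    have e2 : g (T x) = ∫ r in (f x)..(f x + t), Θ (specialProj T f hf0 (x, r)) := by
      have h := intervalIntegral.integral_comp_add_right
        (fun r => Θ (specialProj T f hf0 (x, r))) (a := 0) (b := t) (f x)
      rw [zero_add, add_comm t] at h
      rw [← h, hg]
      have e3 : cocycleSum T f 1 x = f x := by
        have := cocycleSum_succ T f 0 x
        simpa [cocycleSum_zero] using this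
      refine intervalIntegral.integral_congr fun r _ => ?_
      have := specialFlow_cocycleSum_shift (T := T) hf0 hc hf x r 1
      rw [e3, zpow_one] at this
      simp only [this]
    have h1 := intervalIntegral.integral_add_adjacent_intervals (hii x 0 t) (hii x t (f x + t))
    have h2 := intervalIntegral.integral_add_adjacent_intervals (hii x 0 (f x))
      (hii x (f x) (f x + t))
    rw [e1, e2, zero_add]
    simp only [hg]
    linarith
  simp only [key]
  have hTi : Integrable (fun x => g (T x)) μ := hT.integrable_comp_of_integrable hgi
  have hTe : ∫ x, g (T x) ∂μ = ∫ x, g x ∂μ := by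
    have hm := hT.map_eq
    conv_rhs => rw [← hm]
    exact (integral_map hT.measurable.aemeasurable hgm.aestronglyMeasurable).symm
  rw [integral_add hI (show Integrable (fun x => g (T x) - g x) μ from hTi.sub hgi),
    integral_sub hTi hgi, hTe, sub_self, add_zero]

end FlowIntegral

theorem tendsto_zero_of_forall_approx {u : ℕ → ℝ}
    (h : ∀ ε > 0, ∃ v : ℕ → ℝ, Tendsto v atTop (𝓝 0) ∧ ∀ n, |u n - v n| ≤ ε) :
    Tendsto u atTop (𝓝 0) := by
  rw [Metric.tendsto_atTop]
  intro ε hε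
  obtain ⟨v, hv, huv⟩ := h (ε / 2) (half_pos hε)
  obtain ⟨N, hN⟩ := Metric.tendsto_atTop.1 hv (ε / 2) (half_pos hε)
  refine ⟨N, fun n hn => ?_⟩
  have h1 := hN n hn
  have h2 := huv n
  rw [Real.dist_eq, sub_zero] at *
  have h3 : |u n| ≤ |u n - v n| + |v n| := by simpa using abs_add_le (u n - v n) (v n)
  linarith

/-! ### Asymptotically invariant functions on the circle -/

section Decoupling

variable {α : ℝ} {ψ : ℕ → UnitAddCircle → ℝ} {B : ℝ}

theorem fourier_coe_ne_one (hα : Irrational α) {m : ℤ} (hm : m ≠ 0) :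
    fourier m (α : UnitAddCircle) ≠ 1 := by
  intro h
  rw [fourier_apply, ← AddCircle.coe_zsmul] at h
  have h' : AddCircle.toCircle ((m • α : ℝ) : UnitAddCircle) =
      AddCircle.toCircle (0 : UnitAddCircle) := by
    rw [AddCircle.toCircle_zero]
    exact Subtype.ext h
  have h2 := AddCircle.injective_toCircle (one_ne_zero) h'
  rw [AddCircle.coe_eq_zero_iff] at h2
  obtain ⟨n, hn⟩ := h2
  refine (hα.intCast_mul hm).ne_int n ?_
  simpa using hn.symm

theorem integrable_of_measurable_of_abs_le {X : Type*} [MeasurableSpace X] {μ : Measure X}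
    [IsFiniteMeasure μ] {g : X → ℝ} {B : ℝ} (hg : Measurable g) (hB : ∀ x, |g x| ≤ B) :
    Integrable g μ :=
  Integrable.of_bound hg.aestronglyMeasurable B (Eventually.of_forall hB)

/-- Integrating `ψ n (x + α) - ψ n x` against a character multiplies the integral of `ψ n` by a
fixed factor, nonzero since the character is not `1` at `α`. The integral of the difference tends to
`0` by dominated convergence. -/
theorem tendsto_integral_fourier_mul (hα : Irrational α) (hm : ∀ n, Measurable (ψ n))
    (hB : ∀ n x, |ψ n x| ≤ B)
    (hinv : ∀ᵐ x, Tendsto (fun n => ψ n (x + α) - ψ n x) atTop (𝓝 0)) {m : ℤ} (hm0 : m ≠ 0) :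
    Tendsto (fun n => ∫ x : UnitAddCircle, fourier m x * (ψ n x : ℂ)) atTop (𝓝 0) := by
  have hint : ∀ n (a : UnitAddCircle),
      Integrable (fun x => fourier m x * (ψ n (x + a) : ℂ)) volume := by
    intro n a
    refine Integrable.of_bound ?_ B (Eventually.of_forall fun x => ?_)
    · exact ((fourier m).continuous.measurable.mul
        (Complex.measurable_ofReal.comp ((hm n).comp (measurable_add_const a)))).aestronglyMeasurable
    · rw [norm_mul, Complex.norm_real, fourier_apply, Circle.norm_coe, one_mul]
      exact hB n _
  have hint0 : ∀ n, Integrable (fun x : UnitAddCircle => fourier m x * (ψ n x : ℂ)) volume :=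
    fun n => by simpa only [add_zero] using hint n 0
  have h1 : ∀ n, ∫ x : UnitAddCircle, fourier m x * (ψ n x : ℂ) =
      fourier m (α : UnitAddCircle) * ∫ x : UnitAddCircle, fourier m x * (ψ n (x + α) : ℂ) := by
    intro n
    rw [← integral_const_mul, ← integral_add_right_eq_self _ (α : UnitAddCircle)]
    refine integral_congr_ae (Eventually.of_forall fun x => ?_)
    simp only [fourier_apply, smul_add, AddCircle.toCircle_add, Circle.coe_mul]
    ring
  have h2 : Tendsto (fun n => ∫ x : UnitAddCircle, fourier m x * ((ψ n (x + α) - ψ n x : ℝ) : ℂ)) atTop (𝓝 0) := by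
    rw [show (0 : ℂ) = ∫ x : UnitAddCircle, (0 : ℂ) by simp]
    refine tendsto_integral_of_dominated_convergence (fun _ => 2 * B) (fun n => ?_)
      (integrable_const _) (fun n => Eventually.of_forall fun x => ?_) ?_
    · exact ((fourier m).continuous.measurable.mul (Complex.measurable_ofReal.comp
        (((hm n).comp (measurable_add_const _)).sub (hm n)))).aestronglyMeasurable
    · rw [norm_mul, Complex.norm_real, fourier_apply, Circle.norm_coe, one_mul, Real.norm_eq_abs]
      linarith [abs_sub (ψ n (x + α)) (ψ n x), hB n (x + α), hB n x]
    · filter_upwards [hinv] with x hx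
      have := ((Complex.continuous_ofReal.tendsto 0).comp hx).const_mul (fourier m x)
      simpa using this
  have hne := fourier_coe_ne_one hα hm0
  have h3 : ∀ n, ∫ x : UnitAddCircle, fourier m x * (ψ n x : ℂ) =
      (fourier m (α : UnitAddCircle) / (1 - fourier m (α : UnitAddCircle))) *
        ∫ x : UnitAddCircle, fourier m x * ((ψ n (x + α) - ψ n x : ℝ) : ℂ) := by
    intro n
    have e : ∫ x : UnitAddCircle, fourier m x * ((ψ n (x + α) - ψ n x : ℝ) : ℂ) =
        (∫ x : UnitAddCircle, fourier m x * (ψ n (x + α) : ℂ)) -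
          ∫ x : UnitAddCircle, fourier m x * (ψ n x : ℂ) := by
      rw [← integral_sub (hint n α) (hint0 n)]
      refine integral_congr_ae (Eventually.of_forall fun x => ?_)
      simp only
      push_cast
      ring
    have hne' : 1 - fourier m (α : UnitAddCircle) ≠ 0 := sub_ne_zero.2 hne.symm
    rw [e]
    have := h1 n
    field_simp
    linear_combination this
  simp only [h3]
  simpa using h2.const_mul _

/-- Trigonometric polynomials are uniformly dense and the `ψ n` are uniformly bounded; the zero
frequency is covered by the vanishing mean. -/
theorem tendsto_integral_continuousMap_mul (hα : Irrational α) (hm : ∀ n, Measurable (ψ n))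
    (hB : ∀ n x, |ψ n x| ≤ B) (h0 : ∀ n, ∫ x, ψ n x = 0)
    (hinv : ∀ᵐ x, Tendsto (fun n => ψ n (x + α) - ψ n x) atTop (𝓝 0))
    (A : C(UnitAddCircle, ℂ)) :
    Tendsto (fun n => ∫ x : UnitAddCircle, A x * (ψ n x : ℂ)) atTop (𝓝 0) := by
  have hB0 : 0 ≤ B := (abs_nonneg _).trans (hB 0 0)
  have hint : ∀ (A : C(UnitAddCircle, ℂ)) n,
      Integrable (fun x => A x * (ψ n x : ℂ)) volume := by
    intro A n
    refine Integrable.of_bound ?_ (‖A‖ * B) (Eventually.of_forall fun x => ?_)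
    · exact (A.continuous.measurable.mul
        (Complex.measurable_ofReal.comp (hm n))).aestronglyMeasurable
    · rw [norm_mul, Complex.norm_real]
      exact mul_le_mul (A.norm_coe_le_norm x) (hB n x) (norm_nonneg _) (norm_nonneg _)
  have hspan : ∀ A ∈ Submodule.span ℂ (Set.range (fourier (T := (1 : ℝ)))),
      Tendsto (fun n => ∫ x : UnitAddCircle, A x * (ψ n x : ℂ)) atTop (𝓝 0) := by
    intro A hA
    induction hA using Submodule.span_induction with
    | mem A hA =>
      obtain ⟨m, rfl⟩ := hA
      by_cases hm0 : m = 0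
      · subst hm0
        have : ∀ n, ∫ x : UnitAddCircle, fourier 0 x * (ψ n x : ℂ) = 0 := by
          intro n
          simp only [fourier_zero, one_mul]
          rw [integral_complex_ofReal, h0, Complex.ofReal_zero]
        simp only [this, tendsto_const_nhds]
      · exact tendsto_integral_fourier_mul hα hm hB hinv hm0
    | zero => simp
    | add A A' _ _ h h' =>
      have e : ∀ n, ∫ x, (A + A') x * (ψ n x : ℂ) =
          (∫ x, A x * (ψ n x : ℂ)) + ∫ x, A' x * (ψ n x : ℂ) := by
        intro n
        rw [← integral_add (hint A n) (hint A' n)]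
        simp only [ContinuousMap.add_apply, add_mul]
      simp only [e]
      simpa using h.add h'
    | smul a A _ h =>
      have e : ∀ n, ∫ x, (a • A) x * (ψ n x : ℂ) = a * ∫ x, A x * (ψ n x : ℂ) := by
        intro n
        rw [← integral_const_mul]
        simp only [ContinuousMap.smul_apply, smul_eq_mul, mul_assoc]
      simp only [e]
      simpa using h.const_mul a
  rw [Metric.tendsto_atTop]
  intro ε hε
  have hA : A ∈ (Submodule.span ℂ (Set.range (fourier (T := (1 : ℝ))))).topologicalClosure := by
    rw [span_fourier_closure_eq_top]; trivial
  obtain ⟨A', hA', hd⟩ := Metric.mem_closure_iff.1 hA (ε / (2 * (B + 1))) (by positivity)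
  obtain ⟨N, hN⟩ := Metric.tendsto_atTop.1 (hspan A' hA') (ε / 2) (half_pos hε)
  refine ⟨N, fun n hn => ?_⟩
  have h1 := hN n hn
  rw [dist_zero_right] at h1 ⊢
  have e : ∫ x : UnitAddCircle, A x * (ψ n x : ℂ) =
      (∫ x : UnitAddCircle, (A - A') x * (ψ n x : ℂ)) + ∫ x, A' x * (ψ n x : ℂ) := by
    rw [← integral_add (hint _ n) (hint A' n)]
    simp only [ContinuousMap.sub_apply, sub_mul, sub_add_cancel]
  have h2 : ‖∫ x : UnitAddCircle, (A - A') x * (ψ n x : ℂ)‖ ≤ ε / (2 * (B + 1)) * B := by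
    refine (norm_integral_le_of_norm_le_const (C := ε / (2 * (B + 1)) * B)
      (Eventually.of_forall fun x => ?_)).trans (by simp [measureReal_def])
    rw [norm_mul, Complex.norm_real]
    refine mul_le_mul (((A - A').norm_coe_le_norm x).trans ?_) (hB n x) (norm_nonneg _)
      (by positivity)
    rw [← dist_eq_norm]
    exact hd.le
  have h3 : ε / (2 * (B + 1)) * B ≤ ε / 2 := by
    rw [div_mul_eq_mul_div, div_le_div_iff₀ (by positivity) (by positivity)]
    nlinarith
  rw [e]
  linarith [norm_add_le (∫ x : UnitAddCircle, (A - A') x * (ψ n x : ℂ))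
    (∫ x, A' x * (ψ n x : ℂ))]

theorem tendsto_integral_mul_of_integral_eq_zero (hα : Irrational α) (hm : ∀ n, Measurable (ψ n))
    (hB : ∀ n x, |ψ n x| ≤ B) (h0 : ∀ n, ∫ x, ψ n x = 0)
    (hinv : ∀ᵐ x, Tendsto (fun n => ψ n (x + α) - ψ n x) atTop (𝓝 0))
    {A : UnitAddCircle → ℝ} (hA : Integrable A) :
    Tendsto (fun n => ∫ x, A x * ψ n x) atTop (𝓝 0) := by
  have hB0 : 0 ≤ B := (abs_nonneg _).trans (hB 0 0)
  refine tendsto_zero_of_forall_approx fun ε hε => ?_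
  obtain ⟨g, hg, hgi⟩ := hA.exists_boundedContinuous_integral_sub_le
    (show 0 < ε / (B + 1) by positivity)
  refine ⟨fun n => ∫ x, g x * ψ n x, ?_, fun n => ?_⟩
  · have h := tendsto_integral_continuousMap_mul hα hm hB h0 hinv
      ⟨fun x => (g x : ℂ), Complex.continuous_ofReal.comp g.continuous⟩
    have e : ∀ n, ∫ x, ((g x : ℝ) : ℂ) * (ψ n x : ℂ) = ((∫ x, g x * ψ n x : ℝ) : ℂ) := by
      intro n
      rw [← integral_complex_ofReal]
      simp only [Complex.ofReal_mul]
    simp only [ContinuousMap.coe_mk, e] at h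
    simpa [Function.comp_def] using (Complex.continuous_re.tendsto 0).comp h
  · have hi : ∀ {A : UnitAddCircle → ℝ}, Integrable A → Integrable fun x => A x * ψ n x :=
      fun hA => hA.mul_bdd (c := B) (hm n).aestronglyMeasurable (Eventually.of_forall (hB n))
    rw [← integral_sub (hi hA) (hi hgi)]
    calc |∫ x, (A x * ψ n x - g x * ψ n x)| ≤ ∫ x, |A x * ψ n x - g x * ψ n x| :=
          abs_integral_le_integral_abs
      _ ≤ ∫ x, ‖A x - g x‖ * B := by
          refine integral_mono ((hi hA).sub (hi hgi)).abs ((hA.sub hgi).norm.mul_const B) fun x => ?_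
          simp only [← sub_mul, abs_mul]
          exact mul_le_mul_of_nonneg_left (hB n x) (abs_nonneg _)
      _ ≤ ε := by
          rw [integral_mul_const]
          calc _ ≤ ε / (B + 1) * B := mul_le_mul_of_nonneg_right hg hB0
            _ ≤ ε := by
              rw [div_mul_eq_mul_div, div_le_iff₀ (by positivity)]
              nlinarith

/-- Bounded functions which are asymptotically invariant under an irrational rotation are
asymptotically uncorrelated with any integrable function. -/
theorem tendsto_integral_mul_sub_mul_integral (hα : Irrational α) (hm : ∀ n, Measurable (ψ n))
    (hB : ∀ n x, |ψ n x| ≤ B)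
    (hinv : ∀ᵐ x, Tendsto (fun n => ψ n (x + α) - ψ n x) atTop (𝓝 0))
    {A : UnitAddCircle → ℝ} (hA : Integrable A) :
    Tendsto (fun n => (∫ x, A x * ψ n x) - (∫ x, A x) * ∫ x, ψ n x) atTop (𝓝 0) := by
  have hi : ∀ n, Integrable (ψ n) volume :=
    fun n => integrable_of_measurable_of_abs_le (hm n) (hB n)
  have hI : ∀ n, |∫ x, ψ n x| ≤ B := by
    intro n
    have := norm_integral_le_of_norm_le_const (f := ψ n) (C := B)
      (μ := (volume : Measure UnitAddCircle))
      (Eventually.of_forall (hB n))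
    simpa [measureReal_def] using this
  have h := tendsto_integral_mul_of_integral_eq_zero (ψ := fun n x => ψ n x - ∫ y, ψ n y)
    (B := B + B) hα (fun n => (hm n).sub_const _)
    (fun n x => (abs_sub _ _).trans (add_le_add (hB n x) (hI n)))
    (fun n => by rw [integral_sub (hi n) (integrable_const _)]; simp [measureReal_def])
    (by simpa using hinv) hA
  have e : ∀ n, ∫ x, A x * (ψ n x - ∫ y, ψ n y) =
      (∫ x, A x * ψ n x) - (∫ x, A x) * ∫ x, ψ n x := by
    intro n
    rw [← integral_mul_const, ← integral_sub]
    · simp only [mul_sub]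
    · exact hA.mul_bdd (c := B) (hm n).aestronglyMeasurable (Eventually.of_forall (hB n))
    · exact hA.mul_const _
  simpa only [e] using h

end Decoupling

/-! ### Approximation by products of a base function and an exponential -/

section Strip

/-- The measure of the strip `𝕋 × [-R, R]`. -/
noncomputable def stripMeasure (R : ℝ) : Measure (UnitAddCircle × ℝ) :=
  (volume : Measure UnitAddCircle).prod (volume.restrict (Set.Icc (-R) R))

instance (R : ℝ) : IsFiniteMeasure (stripMeasure R) := by
  unfold stripMeasure; infer_instance

/-- Measurable functions on `𝕋 × ℝ` which are bounded on the strip `𝕋 × [-R, R]`. -/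
def BddOnStrip (R : ℝ) (g : UnitAddCircle × ℝ → ℝ) : Prop :=
  Measurable g ∧ ∃ B, ∀ x r, |r| ≤ R → |g (x, r)| ≤ B

theorem BddOnStrip.add {R : ℝ} {g h : UnitAddCircle × ℝ → ℝ} (hg : BddOnStrip R g)
    (hh : BddOnStrip R h) : BddOnStrip R (g + h) := by
  obtain ⟨hgm, B, hB⟩ := hg
  obtain ⟨hhm, B', hB'⟩ := hh
  exact ⟨hgm.add hhm, B + B', fun x r hr =>
    (abs_add_le _ _).trans (add_le_add (hB x r hr) (hB' x r hr))⟩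

theorem BddOnStrip.smul {R : ℝ} {g : UnitAddCircle × ℝ → ℝ} (hg : BddOnStrip R g) (b : ℝ) :
    BddOnStrip R (b • g) := by
  obtain ⟨hgm, B, hB⟩ := hg
  refine ⟨hgm.const_smul b, |b| * B, fun x r hr => ?_⟩
  rw [Pi.smul_apply, smul_eq_mul, abs_mul]
  exact mul_le_mul_of_nonneg_left (hB x r hr) (abs_nonneg _)

theorem bddOnStrip_continuousMap (R : ℝ) (g : C(UnitAddCircle × ℝ, ℝ)) : BddOnStrip R g := by
  refine ⟨g.continuous.measurable, ?_⟩
  obtain ⟨B, hB⟩ := ((isCompact_univ (X := UnitAddCircle)).prod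
    (isCompact_Icc (a := -R) (b := R))).exists_bound_of_continuousOn g.continuous.continuousOn
  exact ⟨B, fun x r hr => hB (x, r) ⟨trivial, abs_le.1 hr⟩⟩

theorem ae_stripMeasure (R : ℝ) : ∀ᵐ z ∂stripMeasure R, |z.2| ≤ R := by
  have h : ∀ᵐ r ∂(volume.restrict (Set.Icc (-R) R)), |r| ≤ R := by
    filter_upwards [ae_restrict_mem measurableSet_Icc] with r hr using abs_le.2 hr
  exact Measure.quasiMeasurePreserving_snd.ae h

theorem BddOnStrip.integrable {R : ℝ} {g : UnitAddCircle × ℝ → ℝ} (hg : BddOnStrip R g) :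
    Integrable g (stripMeasure R) := by
  obtain ⟨hgm, B, hB⟩ := hg
  refine Integrable.of_bound hgm.aestronglyMeasurable B ?_
  filter_upwards [ae_stripMeasure R] with z hz using hB z.1 z.2 hz

/-- The continuous function `(x, r) ↦ a x * exp (ω r)`. -/
noncomputable def mulExp (p : C(UnitAddCircle, ℝ) × ℝ) : C(UnitAddCircle × ℝ, ℝ) where
  toFun z := p.1 z.1 * Real.exp (p.2 * z.2)
  continuous_toFun := by fun_prop

theorem mulExp_apply (p : C(UnitAddCircle, ℝ) × ℝ) (z : UnitAddCircle × ℝ) :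
    mulExp p z = p.1 z.1 * Real.exp (p.2 * z.2) := rfl

/-- Stone–Weierstrass on the compact strip, after an `L¹` approximation by a continuous function.
Exponentials are used in the vertical variable because a shift `r ↦ r - S` merely splits off the
factor `exp (-ω S)`. -/
theorem exists_span_mulExp_approx {R : ℝ} {g : UnitAddCircle × ℝ → ℝ} (hg : BddOnStrip R g)
    {ε : ℝ} (hε : 0 < ε) :
    ∃ g' ∈ Submodule.span ℝ (Set.range mulExp), ∫ z, |g z - g' z| ∂stripMeasure R ≤ ε := by
  set s : Set C(UnitAddCircle × ℝ, ℝ) := Set.range mulExp with hs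
  let N : Submonoid C(UnitAddCircle × ℝ, ℝ) :=
    { carrier := s
      mul_mem' := by
        rintro _ _ ⟨p, rfl⟩ ⟨p', rfl⟩
        refine ⟨(p.1 * p'.1, p.2 + p'.2), ?_⟩
        ext z
        simp only [mulExp_apply, ContinuousMap.mul_apply, add_mul, Real.exp_add]
        ring
      one_mem' := ⟨(1, 0), by ext z; simp [mulExp_apply]⟩ }
  -- The generators are closed under multiplication, so the algebra they generate is just their
  -- linear span.
  have hcl : ((Submonoid.closure s : Submonoid _) : Set C(UnitAddCircle × ℝ, ℝ)) ⊆
      (Submodule.span ℝ s : Set C(UnitAddCircle × ℝ, ℝ)) := by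
    have h1 : Submonoid.closure s ≤ N := Submonoid.closure_le.2 fun _ h => h
    exact fun z hz => Submodule.subset_span (h1 hz)
  have hspan := Algebra.adjoin_eq_span_of_subset ℝ hcl
  have hsep : (Algebra.adjoin ℝ s).SeparatesPoints := by
    rintro ⟨x, r⟩ ⟨y, t⟩ hne
    have hmem : ∀ p, mulExp p ∈ Algebra.adjoin ℝ s := fun p => Algebra.subset_adjoin ⟨p, rfl⟩
    -- Different base points are separated by the distance to one of them, different heights by
    -- `exp`.
    by_cases hrt : r = t
    · have hxy : x ≠ y := fun h => hne (by rw [h, hrt])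
      refine ⟨_, ⟨_, hmem (⟨fun z => dist z x, by fun_prop⟩, 0), rfl⟩, ?_⟩
      simp only [mulExp_apply, zero_mul, Real.exp_zero, mul_one, ContinuousMap.coe_mk, dist_self]
      exact (dist_pos.2 hxy.symm).ne
    · refine ⟨_, ⟨_, hmem (1, 1), rfl⟩, ?_⟩
      simpa [mulExp_apply] using hrt
  obtain ⟨g₁, hg₁, hi₁⟩ := hg.integrable.exists_boundedContinuous_integral_sub_le (half_pos hε)
  set m := (stripMeasure R).real Set.univ with hm
  have hm0 : 0 ≤ m := measureReal_nonneg
  obtain ⟨g', hg', happ⟩ :=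
    ContinuousMap.exists_mem_subalgebra_near_continuous_of_isCompact_of_separatesPoints hsep
      g₁.toContinuousMap ((isCompact_univ (X := UnitAddCircle)).prod
        (isCompact_Icc (a := -R) (b := R))) (show 0 < ε / (2 * (m + 1)) by positivity)
  refine ⟨g', ?_, ?_⟩
  · rw [← hspan]; exact hg'
  have hi' := (bddOnStrip_continuousMap R g').integrable
  have h2 : ∫ z, |g₁ z - g' z| ∂stripMeasure R ≤ ε / 2 := by
    have h3 : ∫ z, |g₁ z - g' z| ∂stripMeasure R ≤ ∫ _, ε / (2 * (m + 1)) ∂stripMeasure R := by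
      refine integral_mono_ae (hi₁.sub hi').abs (integrable_const _) ?_
      filter_upwards [ae_stripMeasure R] with z hz
      have := (happ z ⟨trivial, abs_le.1 hz⟩).le
      rw [Real.norm_eq_abs, abs_sub_comm] at this
      exact this
    refine h3.trans ?_
    rw [integral_const, smul_eq_mul, ← hm, mul_div_assoc', div_le_div_iff₀ (by positivity)
      (by positivity)]
    nlinarith
  calc ∫ z, |g z - g' z| ∂stripMeasure R
      ≤ ∫ z, (‖g z - g₁ z‖ + |g₁ z - g' z|) ∂stripMeasure R := by
        refine integral_mono (hg.integrable.sub hi').abs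
          ((hg.integrable.sub hi₁).norm.add (hi₁.sub hi').abs) fun z => ?_
        exact abs_sub_le _ _ _
    _ ≤ ε := by
        rw [integral_add (show Integrable (fun z => ‖g z - g₁ z‖) (stripMeasure R) from
          (hg.integrable.sub hi₁).norm) (show Integrable (fun z => |g₁ z - g' z|) (stripMeasure R)
          from (hi₁.sub hi').abs)]
        linarith

/-- The bound by the `L¹` norm is uniform in `n`, so convergence on a family with dense span
suffices. -/
theorem tendsto_zero_of_mulExp {R : ℝ} {L : ℕ → (UnitAddCircle × ℝ → ℝ) → ℝ}
    (hadd : ∀ n g h, BddOnStrip R g → BddOnStrip R h → L n (g + h) = L n g + L n h)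
    (hsmul : ∀ n g (b : ℝ), BddOnStrip R g → L n (b • g) = b * L n g)
    {K : ℝ} (hK : ∀ n g, BddOnStrip R g → |L n g| ≤ K * ∫ z, |g z| ∂stripMeasure R)
    (hL : ∀ p, Tendsto (fun n => L n (mulExp p)) atTop (𝓝 0))
    {g : UnitAddCircle × ℝ → ℝ} (hg : BddOnStrip R g) :
    Tendsto (fun n => L n g) atTop (𝓝 0) := by
  have hspan : ∀ g ∈ Submodule.span ℝ (Set.range mulExp),
      Tendsto (fun n => L n g) atTop (𝓝 0) := by
    intro g hg
    induction hg using Submodule.span_induction with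
    | mem g hg => obtain ⟨p, rfl⟩ := hg; exact hL p
    | zero =>
      have h0 : ∀ n, L n ((0 : C(UnitAddCircle × ℝ, ℝ)) : UnitAddCircle × ℝ → ℝ) = 0 := by
        intro n
        have := hsmul n _ 0 (bddOnStrip_continuousMap R 0)
        simpa using this
      simp only [h0, tendsto_const_nhds]
    | add g h _ _ ihg ihh =>
      have e : ∀ n, L n ((g + h : C(UnitAddCircle × ℝ, ℝ)) : UnitAddCircle × ℝ → ℝ) =
          L n g + L n h := fun n =>
        hadd n _ _ (bddOnStrip_continuousMap R g) (bddOnStrip_continuousMap R h)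
      simp only [e]
      simpa using ihg.add ihh
    | smul b g _ ihg =>
      have e : ∀ n, L n ((b • g : C(UnitAddCircle × ℝ, ℝ)) : UnitAddCircle × ℝ → ℝ) =
          b * L n g := fun n => hsmul n _ _ (bddOnStrip_continuousMap R g)
      simp only [e]
      simpa using ihg.const_mul b
  refine tendsto_zero_of_forall_approx fun ε hε => ?_
  obtain ⟨g', hg', happ⟩ := exists_span_mulExp_approx hg (show 0 < ε / (|K| + 1) by positivity)
  refine ⟨_, hspan g' hg', fun n => ?_⟩
  have hb' := bddOnStrip_continuousMap R g'
  have hsub : BddOnStrip R (g + (-1 : ℝ) • (g' : UnitAddCircle × ℝ → ℝ)) := hg.add (hb'.smul _)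
  have e : L n g - L n g' = L n (g + (-1 : ℝ) • (g' : UnitAddCircle × ℝ → ℝ)) := by
    rw [hadd n _ _ hg (hb'.smul _), hsmul n _ _ hb']
    ring
  have e2 : ∀ z, |(g + (-1 : ℝ) • (g' : UnitAddCircle × ℝ → ℝ)) z| = |g z - g' z| := by
    intro z
    simp [sub_eq_add_neg]
  have h1 := hK n _ hsub
  simp only [e2] at h1
  rw [e]
  refine h1.trans ?_
  have hI : 0 ≤ ∫ z, |g z - g' z| ∂stripMeasure R := integral_nonneg fun z => abs_nonneg _
  calc K * ∫ z, |g z - g' z| ∂stripMeasure R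
      ≤ |K| * (ε / (|K| + 1)) := mul_le_mul (le_abs_self K) happ hI (abs_nonneg _)
    _ ≤ ε := by
      rw [mul_div_assoc', div_le_iff₀ (by positivity)]
      nlinarith [abs_nonneg K]

end Strip

/-! ### Trilinear integrals with vertical shifts -/

section Trilinear

variable {Z : Type*} [MeasurableSpace Z] {μ : Measure Z} {C M R Ba : ℝ}
  {a : Z × ℝ → ℝ} {X₁ X₂ : Z → UnitAddCircle} {S W : Z → ℝ} {g h : UnitAddCircle × ℝ → ℝ}

/-- The integral over `Z × [0, C]` of `a (z, r) * g (X₁ z, r - S z) * h (X₂ z, r - W z)`. -/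
noncomputable def trilinearIntegral (μ : Measure Z) (C : ℝ) (a : Z × ℝ → ℝ)
    (X₁ X₂ : Z → UnitAddCircle) (S W : Z → ℝ) (g h : UnitAddCircle × ℝ → ℝ) : ℝ :=
  ∫ z, a z * g (X₁ z.1, z.2 - S z.1) * h (X₂ z.1, z.2 - W z.1)
    ∂μ.prod (volume.restrict (Set.Icc 0 C))

theorem trilinearIntegral_swap :
    trilinearIntegral μ C a X₁ X₂ S W g h = trilinearIntegral μ C a X₂ X₁ W S h g := by
  unfold trilinearIntegral
  simp only [mul_right_comm]

theorem ae_abs_sub_le (hS : ∀ z, |S z| ≤ M) (hR : C + M ≤ R) :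
    ∀ᵐ z ∂μ.prod (volume.restrict (Set.Icc 0 C)), |z.2 - S z.1| ≤ R := by
  have h : ∀ᵐ r ∂(volume.restrict (Set.Icc 0 C)), r ∈ Set.Icc 0 C :=
    ae_restrict_mem measurableSet_Icc
  have h' := (Measure.quasiMeasurePreserving_snd (μ := μ)
    (ν := volume.restrict (Set.Icc 0 C))).ae h
  filter_upwards [h'] with z hz
  have := abs_le.1 (hS z.1)
  rw [abs_le]
  constructor <;> linarith [hz.1, hz.2]

theorem measurable_shift (hX : Measurable X₁) (hS : Measurable S) :
    Measurable fun z : Z × ℝ => (X₁ z.1, z.2 - S z.1) :=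
  (hX.comp measurable_fst).prodMk (measurable_snd.sub (hS.comp measurable_fst))

theorem integrable_trilinear [IsFiniteMeasure μ] (ha : Measurable a) (hBa : ∀ z, |a z| ≤ Ba) (hX₁ : Measurable X₁)
    (hX₂ : Measurable X₂) (hSm : Measurable S) (hWm : Measurable W) (hS : ∀ z, |S z| ≤ M)
    (hW : ∀ z, |W z| ≤ M) (hR : C + M ≤ R) (hg : BddOnStrip R g) (hh : BddOnStrip R h) :
    Integrable (fun z => a z * g (X₁ z.1, z.2 - S z.1) * h (X₂ z.1, z.2 - W z.1))
      (μ.prod (volume.restrict (Set.Icc 0 C))) := by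
  obtain ⟨hgm, B, hB⟩ := hg
  obtain ⟨hhm, B', hB'⟩ := hh
  refine Integrable.of_bound ((ha.mul (hgm.comp (measurable_shift hX₁ hSm))).mul
    (hhm.comp (measurable_shift hX₂ hWm))).aestronglyMeasurable (Ba * B * B') ?_
  filter_upwards [ae_abs_sub_le hS hR, ae_abs_sub_le hW hR] with z h1 h2
  rw [Real.norm_eq_abs, abs_mul, abs_mul]
  have hBa0 := (abs_nonneg _).trans (hBa z)
  have hB0 := (abs_nonneg _).trans (hB (X₁ z.1) _ h1)
  exact mul_le_mul (mul_le_mul (hBa z) (hB _ _ h1) (abs_nonneg _) hBa0) (hB' _ _ h2)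
    (abs_nonneg _) (mul_nonneg hBa0 hB0)

/-- The map `X₁` preserves measure, and a shift of size at most `M` carries `[0, C]` into `[-R, R]`.
-/
theorem integral_abs_shift_le [IsFiniteMeasure μ] (hX₁ : MeasurePreserving X₁ μ volume)
    (hSm : Measurable S) (hS : ∀ z, |S z| ≤ M) (hR : C + M ≤ R) (hg : BddOnStrip R g) :
    ∫ z, |g (X₁ z.1, z.2 - S z.1)| ∂μ.prod (volume.restrict (Set.Icc 0 C)) ≤
      ∫ z, |g z| ∂stripMeasure R := by
  have hgm := hg.1
  have hm : Measurable fun z : Z × ℝ => g (X₁ z.1, z.2 - S z.1) :=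
    hgm.comp (measurable_shift hX₁.measurable hSm)
  have e1 := integral_norm_eq_lintegral_enorm (μ := μ.prod (volume.restrict (Set.Icc 0 C)))
    hm.aestronglyMeasurable
  have e2 := integral_norm_eq_lintegral_enorm (μ := stripMeasure R) hgm.aestronglyMeasurable
  simp only [Real.norm_eq_abs] at e1 e2
  rw [e1, e2]
  refine ENNReal.toReal_mono hg.integrable.2.ne ?_
  unfold stripMeasure
  rw [lintegral_prod _ hgm.enorm.aemeasurable, lintegral_prod _ hm.enorm.aemeasurable,
    ← hX₁.lintegral_comp (f := fun x => ∫⁻ r in Set.Icc (-R) R, ‖g (x, r)‖ₑ)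
      hgm.enorm.lintegral_prod_right']
  refine lintegral_mono fun z => ?_
  have hv : Measurable fun r => ‖g (X₁ z, r)‖ₑ := (hgm.comp measurable_prodMk_left).enorm
  have e3 := (measurePreserving_sub_right volume (S z)).setLIntegral_comp_preimage
    (measurableSet_Icc (a := -R) (b := R)) hv
  rw [← e3]
  refine lintegral_mono_set fun r hr => ?_
  have := abs_le.1 (hS z)
  constructor <;> linarith [hr.1, hr.2]

theorem abs_trilinearIntegral_le [IsFiniteMeasure μ] (ha : Measurable a) (hBa : ∀ z, |a z| ≤ Ba)
    (hX₁ : MeasurePreserving X₁ μ volume)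
    (hX₂ : Measurable X₂) (hSm : Measurable S) (hWm : Measurable W) (hS : ∀ z, |S z| ≤ M)
    (hW : ∀ z, |W z| ≤ M) (hR : C + M ≤ R) (hBa0 : 0 ≤ Ba) (hg : BddOnStrip R g)
    (hhm : Measurable h) {B : ℝ} (hB0 : 0 ≤ B) (hB : ∀ x r, |r| ≤ R → |h (x, r)| ≤ B) :
    |trilinearIntegral μ C a X₁ X₂ S W g h| ≤ Ba * B * ∫ z, |g z| ∂stripMeasure R := by
  have hi := integrable_trilinear (μ := μ) ha hBa hX₁.measurable hX₂ hSm hWm hS hW hR hg ⟨hhm, B, hB⟩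
  have hi2 : Integrable (fun z => |g (X₁ z.1, z.2 - S z.1)|)
      (μ.prod (volume.restrict (Set.Icc 0 C))) := by
    obtain ⟨hgm, Bg, hBg⟩ := hg
    refine Integrable.of_bound
      (hgm.comp (measurable_shift hX₁.measurable hSm)).abs.aestronglyMeasurable Bg ?_
    filter_upwards [ae_abs_sub_le hS hR] with z hz
    rw [Real.norm_eq_abs, abs_abs]
    exact hBg _ _ hz
  calc |trilinearIntegral μ C a X₁ X₂ S W g h|
      ≤ ∫ z, |a z * g (X₁ z.1, z.2 - S z.1) * h (X₂ z.1, z.2 - W z.1)|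
          ∂μ.prod (volume.restrict (Set.Icc 0 C)) := abs_integral_le_integral_abs
    _ ≤ ∫ z, Ba * B * |g (X₁ z.1, z.2 - S z.1)| ∂μ.prod (volume.restrict (Set.Icc 0 C)) := by
        refine integral_mono_ae hi.abs (hi2.const_mul _) ?_
        filter_upwards [ae_abs_sub_le hW hR] with z hz
        rw [abs_mul, abs_mul, mul_right_comm]
        exact mul_le_mul_of_nonneg_right (mul_le_mul (hBa z) (hB _ _ hz) (abs_nonneg _) hBa0)
          (abs_nonneg _)
    _ ≤ _ := by
        rw [integral_const_mul]
        exact mul_le_mul_of_nonneg_left (integral_abs_shift_le hX₁ hSm hS hR hg)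
          (mul_nonneg hBa0 hB0)

theorem trilinearIntegral_add [IsFiniteMeasure μ] (ha : Measurable a) (hBa : ∀ z, |a z| ≤ Ba) (hX₁ : Measurable X₁)
    (hX₂ : Measurable X₂) (hSm : Measurable S) (hWm : Measurable W) (hS : ∀ z, |S z| ≤ M)
    (hW : ∀ z, |W z| ≤ M) (hR : C + M ≤ R) {g' : UnitAddCircle × ℝ → ℝ} (hg : BddOnStrip R g)
    (hg' : BddOnStrip R g') (hh : BddOnStrip R h) :
    trilinearIntegral μ C a X₁ X₂ S W (g + g') h =
      trilinearIntegral μ C a X₁ X₂ S W g h + trilinearIntegral μ C a X₁ X₂ S W g' h := by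
  unfold trilinearIntegral
  rw [← integral_add (integrable_trilinear ha hBa hX₁ hX₂ hSm hWm hS hW hR hg hh)
    (integrable_trilinear ha hBa hX₁ hX₂ hSm hWm hS hW hR hg' hh)]
  simp only [Pi.add_apply, mul_add, add_mul]

theorem trilinearIntegral_smul (b : ℝ) :
    trilinearIntegral μ C a X₁ X₂ S W (b • g) h =
      b * trilinearIntegral μ C a X₁ X₂ S W g h := by
  unfold trilinearIntegral
  rw [← integral_const_mul]
  simp only [Pi.smul_apply, smul_eq_mul]
  congr 1
  funext z
  ring

end Trilinear

instance : IsProbabilityMeasure (volume : Measure UnitAddCircle) :=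
  ⟨UnitAddCircle.measure_univ⟩

/-! ### Decoupling of the vertical shifts from the base point -/

section Asymptotics

variable {α C M R Ba : ℝ} {a : UnitAddCircle × ℝ → ℝ} {v w : ℕ → UnitAddCircle}
  {S W : ℕ → UnitAddCircle → ℝ} {g h : UnitAddCircle × ℝ → ℝ}

/-- The difference between the trilinear integral along `S n`, `W n` and the one in which these
functions are evaluated at an independent point. -/
noncomputable def decouplingDefect (C : ℝ) (a : UnitAddCircle × ℝ → ℝ) (v w : UnitAddCircle)
    (S W : UnitAddCircle → ℝ) (g h : UnitAddCircle × ℝ → ℝ) : ℝ :=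
  trilinearIntegral volume C a (fun x => x + v) (fun x => x + w) S W g h -
    trilinearIntegral ((volume : Measure UnitAddCircle).prod (volume : Measure UnitAddCircle)) C
      (fun z => a (z.1.1, z.2)) Prod.fst Prod.fst (fun z => S z.2) (fun z => W z.2) g h

theorem decouplingDefect_swap {v w : UnitAddCircle} {S W : UnitAddCircle → ℝ} :
    decouplingDefect C a v w S W g h = decouplingDefect C a w v W S h g := by
  unfold decouplingDefect
  rw [trilinearIntegral_swap]
  congr 1
  exact trilinearIntegral_swap

theorem trilinearIntegral_mulExp {v w : UnitAddCircle} {S W : UnitAddCircle → ℝ}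
    (ha : Measurable a) (hBa : ∀ z, |a z| ≤ Ba) (hSm : Measurable S) (hWm : Measurable W)
    (hS : ∀ x, |S x| ≤ M) (hW : ∀ x, |W x| ≤ M) (p p' : C(UnitAddCircle, ℝ) × ℝ) :
    trilinearIntegral volume C a (fun x => x + v) (fun x => x + w) S W (mulExp p) (mulExp p') =
      ∫ x, (∫ r in Set.Icc 0 C, a (x, r) * Real.exp ((p.2 + p'.2) * r)) *
        (p.1 (x + v) * p'.1 (x + w)) * Real.exp (-(p.2 * S x + p'.2 * W x)) := by
  have hi := integrable_trilinear (μ := (volume : Measure UnitAddCircle)) (R := C + M) (C := C)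
    ha hBa (measurable_add_const v) (measurable_add_const w) hSm hWm hS hW le_rfl
    (bddOnStrip_continuousMap _ (mulExp p)) (bddOnStrip_continuousMap _ (mulExp p'))
  unfold trilinearIntegral
  rw [integral_prod _ hi]
  congr 1
  funext x
  rw [← integral_mul_const, ← integral_mul_const]
  congr 1
  funext r
  simp only [mulExp_apply]
  rw [show -(p.2 * S x + p'.2 * W x) = p.2 * (r - S x) + p'.2 * (r - W x) - (p.2 + p'.2) * r by ring,
    Real.exp_sub, Real.exp_add]
  field_simp

theorem trilinearIntegral_prod_mulExp {S W : UnitAddCircle → ℝ}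
    (ha : Measurable a) (hBa : ∀ z, |a z| ≤ Ba) (hSm : Measurable S) (hWm : Measurable W)
    (hS : ∀ x, |S x| ≤ M) (hW : ∀ x, |W x| ≤ M) (p p' : C(UnitAddCircle, ℝ) × ℝ) :
    trilinearIntegral ((volume : Measure UnitAddCircle).prod (volume : Measure UnitAddCircle)) C
      (fun z => a (z.1.1, z.2)) Prod.fst Prod.fst (fun z => S z.2) (fun z => W z.2)
        (mulExp p) (mulExp p') =
      (∫ x, (∫ r in Set.Icc 0 C, a (x, r) * Real.exp ((p.2 + p'.2) * r)) *
        (p.1 x * p'.1 x)) * ∫ x, Real.exp (-(p.2 * S x + p'.2 * W x)) := by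
  have hi := integrable_trilinear (R := C + M) (C := C) (a := fun z => a (z.1.1, z.2))
    (μ := (volume : Measure UnitAddCircle).prod (volume : Measure UnitAddCircle))
    (ha.comp ((measurable_fst.comp measurable_fst).prodMk measurable_snd)) (fun z => hBa _)
    measurable_fst measurable_fst (hSm.comp measurable_snd) (hWm.comp measurable_snd)
    (fun z => hS _) (fun z => hW _) le_rfl
    (bddOnStrip_continuousMap _ (mulExp p)) (bddOnStrip_continuousMap _ (mulExp p'))
  unfold trilinearIntegral
  rw [← integral_prod_mul]
  refine (integral_prod _ hi).trans ?_
  congr 1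
  funext x
  rw [← integral_mul_const, ← integral_mul_const]
  congr 1
  funext r
  simp only [mulExp_apply, Function.comp_apply]
  rw [show -(p.2 * S x.2 + p'.2 * W x.2) =
      p.2 * (r - S x.2) + p'.2 * (r - W x.2) - (p.2 + p'.2) * r by ring,
    Real.exp_sub, Real.exp_add]
  field_simp

theorem abs_le_of_abs_sum {b b' s t : ℝ} (hs : |s| ≤ M) (ht : |t| ≤ M) :
    |-(b * s + b' * t)| ≤ (|b| + |b'|) * M := by
  rw [abs_neg]
  refine (abs_add_le _ _).trans ?_
  rw [abs_mul, abs_mul, add_mul]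
  exact add_le_add (mul_le_mul_of_nonneg_left hs (abs_nonneg _))
    (mul_le_mul_of_nonneg_left ht (abs_nonneg _))

/-- On exponential products the defect is a sum of two errors. The first removes the base shifts `v
n`, `w n` and vanishes by dominated convergence; the second is the covariance of a fixed integrable
function with `exp (-(ω S n + ω' W n))`, which is bounded and asymptotically invariant. -/
theorem tendsto_decouplingDefect_mulExp (hα : Irrational α) (ha : Measurable a)
    (hBa : ∀ z, |a z| ≤ Ba)
    (hSm : ∀ n, Measurable (S n)) (hWm : ∀ n, Measurable (W n))
    (hS : ∀ n x, |S n x| ≤ M) (hW : ∀ n x, |W n x| ≤ M)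
    (hSinv : ∀ᵐ x, Tendsto (fun n => S n (x + α) - S n x) atTop (𝓝 0))
    (hWinv : ∀ᵐ x, Tendsto (fun n => W n (x + α) - W n x) atTop (𝓝 0))
    (hv : Tendsto v atTop (𝓝 0)) (hw : Tendsto w atTop (𝓝 0)) (p p' : C(UnitAddCircle, ℝ) × ℝ) :
    Tendsto (fun n => decouplingDefect C a (v n) (w n) (S n) (W n) (mulExp p) (mulExp p'))
      atTop (𝓝 0) := by
  set A : UnitAddCircle → ℝ :=
    fun x => ∫ r in Set.Icc 0 C, a (x, r) * Real.exp ((p.2 + p'.2) * r) with hA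
  set ψ : ℕ → UnitAddCircle → ℝ := fun n x => Real.exp (-(p.2 * S n x + p'.2 * W n x)) with hψ
  set D : ℝ := Real.exp ((|p.2| + |p'.2|) * M) with hD
  have hψm : ∀ n, Measurable (ψ n) := fun n =>
    Real.measurable_exp.comp (((hSm n).const_mul _).add ((hWm n).const_mul _)).neg
  have hψB : ∀ n x, |ψ n x| ≤ D := by
    intro n x
    rw [hψ, hD, abs_of_pos (Real.exp_pos _)]
    exact Real.exp_le_exp.2 ((le_abs_self _).trans (abs_le_of_abs_sum (hS n x) (hW n x)))
  have hψinv : ∀ᵐ x, Tendsto (fun n => ψ n (x + α) - ψ n x) atTop (𝓝 0) := by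
    filter_upwards [hSinv, hWinv] with x h1 h2
    have h3 : Tendsto (fun n => Real.exp (-(p.2 * (S n (x + α) - S n x) +
        p'.2 * (W n (x + α) - W n x))) - 1) atTop (𝓝 0) := by
      have h4 : Tendsto (fun n => -(p.2 * (S n (x + α) - S n x) +
          p'.2 * (W n (x + α) - W n x))) atTop (𝓝 0) := by
        simpa using ((h1.const_mul p.2).add (h2.const_mul p'.2)).neg
      simpa using ((Real.continuous_exp.tendsto 0).comp h4).sub_const 1
    have h5 := h3.zero_mul_isBoundedUnder_le (g := fun n => ψ n x)
      (isBoundedUnder_of ⟨D, fun n => hψB n x⟩)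
    refine h5.congr fun n => ?_
    simp only [hψ]
    rw [sub_mul, ← Real.exp_add, one_mul]
    congr 2
    ring
  have hAm : Measurable A :=
    (StronglyMeasurable.integral_prod_right (f := fun x r =>
      a (x, r) * Real.exp ((p.2 + p'.2) * r)) (ν := volume.restrict (Set.Icc 0 C))
      (ha.mul (Real.measurable_exp.comp
        (measurable_snd.const_mul _))).stronglyMeasurable).measurable
  have hAi : Integrable A := by
    have : Integrable (fun z : UnitAddCircle × ℝ => a z * Real.exp ((p.2 + p'.2) * z.2))
        (volume.prod (volume.restrict (Set.Icc 0 C))) := by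
      refine Integrable.of_bound (ha.mul (Real.measurable_exp.comp
        (measurable_snd.const_mul _))).aestronglyMeasurable
        (Ba * Real.exp (|p.2 + p'.2| * C)) ?_
      have h : ∀ᵐ r ∂(volume.restrict (Set.Icc 0 C)), r ∈ Set.Icc 0 C :=
        ae_restrict_mem measurableSet_Icc
      have h' := (Measure.quasiMeasurePreserving_snd (μ := (volume : Measure UnitAddCircle))
        (ν := volume.restrict (Set.Icc 0 C))).ae h
      filter_upwards [h'] with z hz
      rw [Real.norm_eq_abs, abs_mul, abs_of_pos (Real.exp_pos _)]
      refine mul_le_mul (hBa z) (Real.exp_le_exp.2 ?_) (Real.exp_pos _).le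
        ((abs_nonneg _).trans (hBa z))
      refine (le_abs_self _).trans ?_
      rw [abs_mul, abs_of_nonneg hz.1]
      exact mul_le_mul_of_nonneg_left hz.2 (abs_nonneg _)
    exact this.integral_prod_left
  have hbd : ∀ (x y z : UnitAddCircle), |A x * (p.1 y * p'.1 z)| ≤ |A x| * (‖p.1‖ * ‖p'.1‖) := by
    intro x y z
    rw [abs_mul, abs_mul]
    exact mul_le_mul_of_nonneg_left (mul_le_mul (p.1.norm_coe_le_norm y)
      (p'.1.norm_coe_le_norm z) (abs_nonneg _) (norm_nonneg _)) (abs_nonneg _)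
  have hm1 : ∀ n, Measurable fun x => A x * (p.1 (x + v n) * p'.1 (x + w n)) := fun n =>
    hAm.mul ((p.1.continuous.measurable.comp (measurable_add_const _)).mul
      (p'.1.continuous.measurable.comp (measurable_add_const _)))
  have hm2 : Measurable fun x => A x * (p.1 x * p'.1 x) :=
    hAm.mul (p.1.continuous.measurable.mul p'.1.continuous.measurable)
  have hi1 : ∀ n, Integrable fun x => A x * (p.1 (x + v n) * p'.1 (x + w n)) := fun n =>
    (hAi.abs.mul_const (‖p.1‖ * ‖p'.1‖)).mono' (hm1 n).aestronglyMeasurable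
      (Eventually.of_forall fun x => hbd x _ _)
  have hi2 : Integrable fun x => A x * (p.1 x * p'.1 x) :=
    (hAi.abs.mul_const (‖p.1‖ * ‖p'.1‖)).mono' hm2.aestronglyMeasurable
      (Eventually.of_forall fun x => hbd x _ _)
  have hmulψ : ∀ {u : UnitAddCircle → ℝ} n, Integrable u → Integrable fun x => u x * ψ n x :=
    fun n hu => hu.mul_bdd (c := D) (hψm n).aestronglyMeasurable (Eventually.of_forall (hψB n))
  have hfirst : Tendsto (fun n => ∫ x, (A x * (p.1 (x + v n) * p'.1 (x + w n)) * ψ n x -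
      A x * (p.1 x * p'.1 x) * ψ n x)) atTop (𝓝 0) := by
    rw [show (0 : ℝ) = ∫ x : UnitAddCircle, (0 : ℝ) by simp]
    refine tendsto_integral_of_dominated_convergence
      (fun x => 2 * (|A x| * (‖p.1‖ * ‖p'.1‖)) * D) (fun n => ?_)
      (((hAi.abs.mul_const _).const_mul 2).mul_const D)
      (fun n => Eventually.of_forall fun x => ?_) (Eventually.of_forall fun x => ?_)
    · exact (((hm1 n).mul (hψm n)).sub (hm2.mul (hψm n))).aestronglyMeasurable
    · rw [← sub_mul, norm_mul, Real.norm_eq_abs, Real.norm_eq_abs]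
      have h1 := hbd x (x + v n) (x + w n)
      have h2 := hbd x x x
      have h3 := abs_sub (A x * (p.1 (x + v n) * p'.1 (x + w n))) (A x * (p.1 x * p'.1 x))
      exact mul_le_mul (by linarith) (hψB n x) (abs_nonneg _)
        (mul_nonneg zero_le_two (mul_nonneg (abs_nonneg _)
          (mul_nonneg (norm_nonneg _) (norm_nonneg _))))
    · have hcv : Tendsto (fun n => p.1 (x + v n)) atTop (𝓝 (p.1 x)) :=
        (p.1.continuous.tendsto x).comp (by simpa using hv.const_add x)
      have hcw : Tendsto (fun n => p'.1 (x + w n)) atTop (𝓝 (p'.1 x)) :=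
        (p'.1.continuous.tendsto x).comp (by simpa using hw.const_add x)
      have h1 : Tendsto (fun n => A x * (p.1 (x + v n) * p'.1 (x + w n)) -
          A x * (p.1 x * p'.1 x)) atTop (𝓝 0) := by
        simpa using ((hcv.mul hcw).const_mul (A x)).sub_const (A x * (p.1 x * p'.1 x))
      have h2 := h1.zero_mul_isBoundedUnder_le (g := fun n => ψ n x)
        (isBoundedUnder_of ⟨D, fun n => hψB n x⟩)
      simpa only [sub_mul] using h2
  have hsecond := tendsto_integral_mul_sub_mul_integral hα hψm hψB hψinv hi2
  have e : ∀ n, decouplingDefect C a (v n) (w n) (S n) (W n) (mulExp p) (mulExp p') =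
      (∫ x, (A x * (p.1 (x + v n) * p'.1 (x + w n)) * ψ n x - A x * (p.1 x * p'.1 x) * ψ n x)) +
      ((∫ x, A x * (p.1 x * p'.1 x) * ψ n x) -
        (∫ x, A x * (p.1 x * p'.1 x)) * ∫ x, ψ n x) := by
    intro n
    rw [decouplingDefect, trilinearIntegral_mulExp ha hBa (hSm n) (hWm n) (hS n) (hW n),
      trilinearIntegral_prod_mulExp ha hBa (hSm n) (hWm n) (hS n) (hW n),
      integral_sub (hmulψ n (hi1 n)) (hmulψ n hi2)]
    ring
  simp only [e]
  simpa using hfirst.add hsecond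

theorem tendsto_decouplingDefect_left (hBa : ∀ z, |a z| ≤ Ba) (ha : Measurable a)
    (hSm : ∀ n, Measurable (S n)) (hWm : ∀ n, Measurable (W n))
    (hS : ∀ n x, |S n x| ≤ M) (hW : ∀ n x, |W n x| ≤ M) (hR : C + M ≤ R)
    (hh : BddOnStrip R h)
    (hexp : ∀ p, Tendsto (fun n => decouplingDefect C a (v n) (w n) (S n) (W n) (mulExp p) h)
      atTop (𝓝 0)) (hg : BddOnStrip R g) :
    Tendsto (fun n => decouplingDefect C a (v n) (w n) (S n) (W n) g h) atTop (𝓝 0) := by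
  obtain ⟨hhm, B, hB⟩ := id hh
  have hB' : ∀ x r, |r| ≤ R → |h (x, r)| ≤ |B| := fun x r hr => (hB x r hr).trans (le_abs_self B)
  have hBa0 : 0 ≤ Ba := (abs_nonneg _).trans (hBa 0)
  have ha' : Measurable fun z : (UnitAddCircle × UnitAddCircle) × ℝ => a (z.1.1, z.2) :=
    ha.comp ((measurable_fst.comp measurable_fst).prodMk measurable_snd)
  have hSm' : ∀ n, Measurable fun z : UnitAddCircle × UnitAddCircle => S n z.2 :=
    fun n => (hSm n).comp measurable_snd
  have hWm' : ∀ n, Measurable fun z : UnitAddCircle × UnitAddCircle => W n z.2 :=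
    fun n => (hWm n).comp measurable_snd
  refine tendsto_zero_of_mulExp (R := R)
    (L := fun n g => decouplingDefect C a (v n) (w n) (S n) (W n) g h)
    (K := 2 * (Ba * |B|)) ?_ ?_ ?_ hexp hg
  · intro n g g' hg hg'
    simp only [decouplingDefect]
    rw [trilinearIntegral_add ha hBa (measurable_add_const _) (measurable_add_const _) (hSm n)
      (hWm n) (hS n) (hW n) hR hg hg' hh, trilinearIntegral_add ha' (fun z => hBa _)
      measurable_fst measurable_fst (hSm' n) (hWm' n)
      (fun z => hS n _) (fun z => hW n _) hR hg hg' hh]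
    ring
  · intro n g b _
    simp only [decouplingDefect, trilinearIntegral_smul]
    ring
  · intro n g hg
    have h1 := abs_trilinearIntegral_le (C := C) ha hBa
      (measurePreserving_add_right (volume : Measure UnitAddCircle) (v n))
      (measurable_add_const (w n)) (hSm n) (hWm n) (hS n) (hW n) hR hBa0 hg hhm (abs_nonneg B) hB'
    have h2 := abs_trilinearIntegral_le (C := C) ha' (fun z => hBa _)
      (measurePreserving_fst (μ := (volume : Measure UnitAddCircle))
        (ν := (volume : Measure UnitAddCircle)))
      measurable_fst (hSm' n) (hWm' n)
      (fun z => hS n _) (fun z => hW n _) hR hBa0 hg hhm (abs_nonneg B) hB'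
    have h3 := abs_sub (trilinearIntegral volume C a (fun x => x + v n) (fun x => x + w n)
      (S n) (W n) g h) (trilinearIntegral
      ((volume : Measure UnitAddCircle).prod (volume : Measure UnitAddCircle)) C
      (fun z => a (z.1.1, z.2)) Prod.fst Prod.fst (fun z => S n z.2) (fun z => W n z.2) g h)
    simp only [decouplingDefect]
    linarith

/-- If `S n`, `W n` are uniformly bounded and asymptotically invariant under an irrational
rotation, then they become independent of the base point in trilinear integrals. -/
theorem tendsto_decouplingDefect (hα : Irrational α) (ha : Measurable a)
    (hBa : ∀ z, |a z| ≤ Ba)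
    (hSm : ∀ n, Measurable (S n)) (hWm : ∀ n, Measurable (W n))
    (hS : ∀ n x, |S n x| ≤ M) (hW : ∀ n x, |W n x| ≤ M) (hR : C + M ≤ R)
    (hSinv : ∀ᵐ x, Tendsto (fun n => S n (x + α) - S n x) atTop (𝓝 0))
    (hWinv : ∀ᵐ x, Tendsto (fun n => W n (x + α) - W n x) atTop (𝓝 0))
    (hv : Tendsto v atTop (𝓝 0)) (hw : Tendsto w atTop (𝓝 0))
    (hg : BddOnStrip R g) (hh : BddOnStrip R h) :
    Tendsto (fun n => decouplingDefect C a (v n) (w n) (S n) (W n) g h) atTop (𝓝 0) := by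
  refine tendsto_decouplingDefect_left hBa ha hSm hWm hS hW hR hh (fun p => ?_) hg
  -- The first function is now an exponential product; exchanging the two roles reduces the second
  -- one in the same way.
  simp only [decouplingDefect_swap (g := mulExp p)]
  refine tendsto_decouplingDefect_left hBa ha hWm hSm hW hS hR (bddOnStrip_continuousMap R _)
    (fun p' => ?_) hh
  exact tendsto_decouplingDefect_mulExp hα ha hBa hWm hSm hW hS hWinv hSinv hw hv p' p

end Asymptotics

/-! ### Continued fractions: convergents and best approximation -/

section Convergents

/-- Integer sequences with the properties of numerators and denominators of the convergents of
the continued fraction of an irrational number `α`. -/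
structure IsConvergentSeq (α : ℝ) (p q : ℕ → ℤ) : Prop where
  one_le : ∀ k, 1 ≤ q k
  recurrence : ∀ k, ∃ b : ℤ, 1 ≤ b ∧ q (k + 2) = b * q (k + 1) + q k ∧
    p (k + 2) = b * p (k + 1) + p k
  det : ∀ k, p k * q (k + 1) - q k * p (k + 1) = (-1) ^ (k + 1)
  le_succ : ∀ k, q k ≤ q (k + 1)
  sign : ∀ k, 0 ≤ (-1) ^ k * (q k * α - p k)

theorem not_terminatedAt_of_irrational {α : ℝ} (hα : Irrational α) (n : ℕ) :
    ¬(GenContFract.of α).TerminatedAt n := by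
  intro h
  obtain ⟨r, hr⟩ := (GenContFract.terminates_iff_rat α).1 ⟨n, h⟩
  exact hα ⟨r, hr.symm⟩

theorem exists_partDen_of_irrational {α : ℝ} (hα : Irrational α) (n : ℕ) :
    ∃ b : ℤ, 1 ≤ b ∧ (GenContFract.of α).s.get? n = some ⟨1, (b : ℝ)⟩ := by
  have h := not_terminatedAt_of_irrational hα n
  obtain ⟨gp, hgp⟩ := Option.ne_none_iff_exists'.1
    (show (GenContFract.of α).s.get? n ≠ none from h)
  obtain ⟨ha, b, hb⟩ := GenContFract.of_partNum_eq_one_and_exists_int_partDen_eq hgp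
  refine ⟨b, ?_, ?_⟩
  · have := GenContFract.of_one_le_get?_partDen (GenContFract.partDen_eq_s_b hgp)
    rw [hb] at this
    exact_mod_cast this
  · rw [hgp, ← ha, ← hb]

theorem exists_convergentSeq {α : ℝ} (hα : Irrational α) :
    ∃ p q : ℕ → ℤ, (∀ k, cfDenom α k = q k) ∧ IsConvergentSeq α p q := by
  set g := GenContFract.of α with hg
  have hrec : ∀ k, ∃ b : ℤ, 1 ≤ b ∧ g.dens (k + 2) = b * g.dens (k + 1) + g.dens k ∧
      g.nums (k + 2) = b * g.nums (k + 1) + g.nums k := by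
    intro k
    obtain ⟨b, hb, hs⟩ := exists_partDen_of_irrational hα (k + 1)
    refine ⟨b, hb, ?_, ?_⟩
    · simpa using GenContFract.dens_recurrence hs rfl rfl
    · simpa using GenContFract.nums_recurrence hs rfl rfl
  obtain ⟨b₀, hb₀, hs₀⟩ := exists_partDen_of_irrational hα 0
  -- Integrality is carried for two consecutive indices, as the recurrence has two terms.
  have hint : ∀ k, ((∃ a : ℤ, g.nums k = a) ∧ ∃ a : ℤ, g.dens k = a) ∧
      (∃ a : ℤ, g.nums (k + 1) = a) ∧ ∃ a : ℤ, g.dens (k + 1) = a := by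
    intro k
    induction k with
    | zero =>
      refine ⟨⟨⟨⌊α⌋, ?_⟩, 1, ?_⟩, ⟨b₀ * ⌊α⌋ + 1, ?_⟩, b₀, ?_⟩
      · rw [GenContFract.zeroth_num_eq_h, hg, GenContFract.of_h_eq_floor]
      · rw [GenContFract.zeroth_den_eq_one]; norm_num
      · rw [GenContFract.first_num_eq hs₀, GenContFract.of_h_eq_floor]; push_cast; ring
      · rw [GenContFract.first_den_eq hs₀]
    | succ k ih =>
      refine ⟨ih.2, ?_⟩
      obtain ⟨⟨⟨a, ha⟩, a', ha'⟩, ⟨d, hd⟩, d', hd'⟩ := ih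
      obtain ⟨b, -, h1, h2⟩ := hrec k
      refine ⟨⟨b * d + a, ?_⟩, b * d' + a', ?_⟩
      · rw [h2, ha, hd]; push_cast; ring
      · rw [h1, ha', hd']; push_cast; ring
  choose p hp using fun k => (hint k).1.1
  choose q hq using fun k => (hint k).1.2
  have hone : ∀ k, 1 ≤ q k := by
    intro k
    have h := GenContFract.succ_nth_fib_le_of_nth_den (v := α) (n := k)
      (Or.inr (not_terminatedAt_of_irrational hα _))
    rw [← hg, hq] at h
    have h' : ((1 : ℕ) : ℝ) ≤ (Nat.fib (k + 1) : ℝ) :=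
      Nat.cast_le.2 (Nat.fib_pos.2 k.succ_pos)
    exact_mod_cast h'.trans h
  refine ⟨p, q, fun k => hq k, ⟨hone, fun k => ?_, fun k => ?_, fun k => ?_, fun k => ?_⟩⟩
  · obtain ⟨b, hb, h1, h2⟩ := hrec k
    simp only [hp, hq] at h1 h2
    exact ⟨b, hb, by exact_mod_cast h1, by exact_mod_cast h2⟩
  · have h := SimpContFract.determinant (s := SimpContFract.of α)
      (not_terminatedAt_of_irrational hα k)
    change g.nums k * g.dens (k + 1) - g.dens k * g.nums (k + 1) = _ at h
    simp only [hp, hq] at h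
    exact_mod_cast h
  · have h := GenContFract.of_den_mono (v := α) (n := k)
    rw [← hg, hq, hq] at h
    exact_mod_cast h
  · have hstream : ∃ ifp, GenContFract.IntFractPair.stream α k = some ifp := by
      rw [← Option.ne_none_iff_exists']
      cases k with
      | zero => simp [GenContFract.IntFractPair.stream]
      | succ k =>
        intro h
        exact not_terminatedAt_of_irrational hα k
          (GenContFract.of_terminatedAt_n_iff_succ_nth_intFractPair_stream_eq_none.2 h)
    obtain ⟨ifp, hifp⟩ := hstream
    have h := GenContFract.sub_convs_eq hifp
    simp only at h
    rw [← hg] at h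
    have hqpos : (0 : ℝ) < q k := by exact_mod_cast (hone k)
    have hB : (g.contsAux (k + 1)).b = q k := hq k
    have hpB : 0 ≤ (g.contsAux k).b := GenContFract.zero_le_of_contsAux_b
    have hfr := GenContFract.IntFractPair.nth_stream_fr_nonneg hifp
    have hconv : g.convs k = p k / q k := by
      rw [GenContFract.conv_eq_num_div_den, hp, hq]
    rw [hB, hconv] at h
    have e : (-1) ^ k * ((q k : ℝ) * α - p k) = q k * ((-1) ^ k * (α - p k / q k)) := by
      field_simp
    rw [e]
    refine mul_nonneg hqpos.le ?_
    rw [h]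
    split_ifs with h0
    · simp
    · rw [mul_div_assoc', ← mul_pow]
      norm_num
      positivity

variable {α : ℝ} {p q : ℕ → ℤ}

namespace IsConvergentSeq

theorem q_pos (H : IsConvergentSeq α p q) (k : ℕ) : (0 : ℝ) < q k := by exact_mod_cast (H.one_le k)

theorem abs_sub_eq (H : IsConvergentSeq α p q) (k : ℕ) : |q k * α - p k| = (-1) ^ k * (q k * α - p k) := by
  rw [← abs_of_nonneg (H.sign k), abs_mul, abs_pow, abs_neg, abs_one, one_pow, one_mul]

/-- The determinant identity, in which consecutive errors `q_k α - p_k` have opposite signs, so that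
absolute values add. -/
theorem abs_mul_add_abs_mul (H : IsConvergentSeq α p q) (k : ℕ) :
    |q k * α - p k| * q (k + 1) + |q (k + 1) * α - p (k + 1)| * q k = 1 := by
  have hd : (p k : ℝ) * q (k + 1) - q k * p (k + 1) = (-1) ^ (k + 1) := by
    exact_mod_cast H.det k
  have hs : ((-1 : ℝ) ^ k) * (-1) ^ k = 1 := by rw [← mul_pow]; norm_num
  rw [H.abs_sub_eq, H.abs_sub_eq, pow_succ] at *
  linear_combination (-(-1) ^ k) * hd + hs

/-- The absolute errors satisfy `D_{k+2} = D_k - b D_{k+1}` with `b ≥ 1`, and `D_{k+2} ≥ 0`. -/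
theorem abs_succ_le (H : IsConvergentSeq α p q) (k : ℕ) : |q (k + 1) * α - p (k + 1)| ≤ |q k * α - p k| := by
  obtain ⟨b, hb, hq, hp⟩ := H.recurrence k
  have hq' : (q (k + 2) : ℝ) = b * q (k + 1) + q k := by exact_mod_cast hq
  have hp' : (p (k + 2) : ℝ) = b * p (k + 1) + p k := by exact_mod_cast hp
  have hb' : (1 : ℝ) ≤ b := by exact_mod_cast hb
  have h2 := H.sign (k + 2)
  have e : (-1) ^ (k + 2) * ((q (k + 2) : ℝ) * α - p (k + 2)) =
      |q k * α - p k| - b * |q (k + 1) * α - p (k + 1)| := by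
    rw [H.abs_sub_eq, H.abs_sub_eq, hq', hp']
    ring
  rw [e] at h2
  nlinarith [abs_nonneg ((q (k + 1) : ℝ) * α - p (k + 1))]

theorem abs_le_one_div (H : IsConvergentSeq α p q) (k : ℕ) : |q k * α - p k| ≤ 1 / q (k + 1) := by
  have h := H.abs_mul_add_abs_mul k
  have h1 := H.q_pos k
  rw [le_div_iff₀ (H.q_pos (k + 1))]
  nlinarith [abs_nonneg ((q (k + 1) : ℝ) * α - p (k + 1))]

/-- Expand `(j, i)` in the unimodular basis `(q_k, p_k)`, `(q_{k+1}, p_{k+1})` with coefficients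
`u`, `v`. The range of `j` forces `u ≠ 0` and excludes `u`, `v` of equal sign; as the errors
alternate in sign, the two contributions add up in absolute value, to at least `|u|` times the first
error. -/
theorem abs_le_abs_of_lt (H : IsConvergentSeq α p q) (k : ℕ) {j : ℤ} (hj0 : 0 < j) (hj : j < q (k + 1)) (i : ℤ) :
    |q k * α - p k| ≤ |j * α - i| := by
  set s : ℤ := (-1) ^ (k + 1) with hs
  have hss : s * s = 1 := by rw [hs, ← mul_pow]; norm_num
  have hdet := H.det k
  rw [← hs] at hdet
  set u : ℤ := s * (i * q (k + 1) - j * p (k + 1)) with hu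
  set v : ℤ := s * (j * p k - i * q k) with hv
  have hj' : j = u * q k + v * q (k + 1) := by
    rw [hu, hv]
    linear_combination (-j) * hss + (-s * j) * hdet
  have hi' : i = u * p k + v * p (k + 1) := by
    rw [hu, hv]
    linear_combination (-i) * hss + (-s * i) * hdet
  have hu0 : u ≠ 0 := by
    intro h0
    rw [h0, zero_mul, zero_add] at hj'
    have h1 := H.one_le (k + 1)
    rcases le_or_gt v 0 with h | h
    · nlinarith
    · nlinarith
  have hDk := H.sign k
  have hDk1 := H.sign (k + 1)
  have e : (j : ℝ) * α - i =
      (-1) ^ k * (u * ((-1) ^ k * (q k * α - p k)) -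
        v * ((-1) ^ (k + 1) * (q (k + 1) * α - p (k + 1)))) := by
    have hs' : ((-1 : ℝ) ^ k) * (-1) ^ k = 1 := by rw [← mul_pow]; norm_num
    have h1 : (j : ℝ) = u * q k + v * q (k + 1) := by exact_mod_cast hj'
    have h2 : (i : ℝ) = u * p k + v * p (k + 1) := by exact_mod_cast hi'
    rw [h1, h2, pow_succ]
    linear_combination (-(u * (q k * α - p k) + v * (q (k + 1) * α - p (k + 1)))) * hs'
  rw [e, abs_mul, abs_pow, abs_neg, abs_one, one_pow, one_mul, H.abs_sub_eq]
  set X := (-1 : ℝ) ^ k * (q k * α - p k)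
  set Y := (-1 : ℝ) ^ (k + 1) * (q (k + 1) * α - p (k + 1))
  have hq0 := H.one_le k
  have hq1 := H.one_le (k + 1)
  rcases lt_or_gt_of_ne hu0 with h | h
  · have hv0 : 0 ≤ v := by
      by_contra! hv
      nlinarith
    have h1 : (u : ℝ) ≤ -1 := by exact_mod_cast (by omega : u ≤ -1)
    have h2 : (0 : ℝ) ≤ v := by exact_mod_cast hv0
    refine le_trans ?_ (neg_le_abs _)
    nlinarith [mul_nonneg h2 hDk1]
  · have hv0 : v ≤ 0 := by
      by_contra! hv
      nlinarith
    have h1 : (1 : ℝ) ≤ u := by exact_mod_cast h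
    have h2 : (v : ℝ) ≤ 0 := by exact_mod_cast hv0
    refine le_trans ?_ (le_abs_self _)
    nlinarith [mul_nonneg (neg_nonneg.2 h2) hDk1]

theorem nat_le (H : IsConvergentSeq α p q) (k : ℕ) : (k : ℤ) ≤ q (k + 1) := by
  induction k with
  | zero => have := H.one_le 1; push_cast; linarith
  | succ k ih =>
    obtain ⟨b, hb, hq, -⟩ := H.recurrence k
    have := H.one_le k
    have := H.one_le (k + 1)
    push_cast
    rw [hq]
    nlinarith

end IsConvergentSeq

end Convergents

/-! ### Birkhoff sums of the sawtooth: Denjoy–Koksma bound and third moment -/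

section Sawtooth

/-- The function `x ↦ x - 1/2` on the circle identified with `[0, 1)`. -/
noncomputable def sawtooth (x : UnitAddCircle) : ℝ :=
  (AddCircle.equivIco (1 : ℝ) 0 x : ℝ) - 1 / 2

/-- The Birkhoff sums of the sawtooth function over the rotation by `α`. -/
noncomputable def sawSum (α : ℝ) (q : ℕ) (x : UnitAddCircle) : ℝ :=
  ∑ j ∈ Finset.range q, sawtooth (x + ((j * α : ℝ) : UnitAddCircle))

theorem sawtooth_coe (t : ℝ) : sawtooth (t : UnitAddCircle) = Int.fract t - 1 / 2 := by
  have := AddCircle.coe_equivIco_mk_apply (p := (1 : ℝ)) t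
  simp only [div_one, mul_one] at this
  rw [sawtooth]
  congr 1

theorem measurable_sawtooth : Measurable sawtooth :=
  (measurable_subtype_coe.comp (AddCircle.measurableEquivIco (1 : ℝ) 0).measurable).sub_const _

theorem abs_sawtooth_le (x : UnitAddCircle) : |sawtooth x| ≤ 1 / 2 := by
  induction x using QuotientAddGroup.induction_on with
  | H t =>
    have h := sawtooth_coe t
    rw [h, abs_le]
    have := Int.fract_nonneg t
    have := Int.fract_lt_one t
    constructor <;> linarith

theorem continuousAt_sawtooth {x : UnitAddCircle} (hx : x ≠ 0) : ContinuousAt sawtooth x :=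
  (continuous_subtype_val.continuousAt.comp
    (AddCircle.continuousAt_equivIco (1 : ℝ) 0 (by simpa using hx))).sub continuousAt_const

theorem measurable_sawSum (α : ℝ) (q : ℕ) : Measurable (sawSum α q) :=
  Finset.measurable_fun_sum _ fun _ _ => measurable_sawtooth.comp (measurable_add_const _)

/-- Telescoping. When `qα → 0` the right-hand side tends to `0` away from the discontinuity, which
is the source of asymptotic invariance. -/
theorem sawSum_add_self (α : ℝ) (q : ℕ) (x : UnitAddCircle) :
    sawSum α q (x + α) - sawSum α q x =
      sawtooth (x + ((q * α : ℝ) : UnitAddCircle)) - sawtooth x := by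
  induction q with
  | zero => simp [sawSum]
  | succ q ih =>
    unfold sawSum at ih ⊢
    rw [Finset.sum_range_succ, Finset.sum_range_succ]
    have e : x + (α : UnitAddCircle) + ((q * α : ℝ) : UnitAddCircle) =
        x + (((q + 1 : ℕ) * α : ℝ) : UnitAddCircle) := by
      rw [add_assoc, ← AddCircle.coe_add]
      congr 2
      push_cast
      ring
    rw [e]
    linarith

/-- A perturbation of size at most `1/q` can cross an integer only from the first or the last of the
`q` intervals of length `1/q`; there the trivial bound `1` is used. -/
theorem abs_fract_add_sub_le {q : ℕ} (hq : 0 < q) {i : ℕ} (hi : i < q) {θ δ : ℝ} (hθ0 : 0 ≤ θ)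
    (hθ1 : θ < 1) (hδ : |δ| ≤ 1 / q) :
    |Int.fract ((i + θ) / q + δ) - (i + θ) / q| ≤
      1 / q + ((if i = 0 then 1 else 0) + if i = q - 1 then 1 else 0) := by
  have hq' : (0 : ℝ) < q := Nat.cast_pos.2 hq
  have hz0 : 0 ≤ (i + θ) / q := by positivity
  have hi' : (i : ℝ) + 1 ≤ q := by exact_mod_cast hi
  have hz1 : (i + θ) / q < 1 := by
    rw [div_lt_one hq']
    linarith
  have hqi : (0 : ℝ) ≤ 1 / q := by positivity
  have h1 : |Int.fract ((i + θ) / q + δ) - (i + θ) / q| ≤ 1 := by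
    rw [abs_le]
    have := Int.fract_nonneg ((i + θ) / q + δ)
    have := Int.fract_lt_one ((i + θ) / q + δ)
    constructor <;> linarith
  by_cases h0 : i = 0
  · rw [if_pos h0]
    split_ifs <;> linarith
  by_cases h2 : i = q - 1
  · rw [if_pos h2, if_neg h0]
    linarith
  rw [if_neg h0, if_neg h2, add_zero, add_zero]
  have hi1 : (1 : ℝ) ≤ i := by exact_mod_cast (by omega : 1 ≤ i)
  have hi2 : (i : ℝ) + 2 ≤ q := by exact_mod_cast (by omega : i + 2 ≤ q)
  have a1 : 1 / (q : ℝ) ≤ (i + θ) / q := by gcongr; linarith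
  have a2 : (i + θ) / q < (q - 1) / q := by gcongr; linarith
  rw [sub_div, div_self hq'.ne'] at a2
  have hδ' := abs_le.1 hδ
  rw [Int.fract_eq_self.2 ⟨by linarith, by linarith⟩]
  simpa using hδ

theorem sum_emod_eq {q : ℕ} (hq : 0 < q) {p : ℤ} (hcop : IsCoprime p q) (m : ℤ) (φ : ℕ → ℝ) :
    ∑ j ∈ Finset.range q, φ (((m + j * p) % q).toNat) = ∑ i ∈ Finset.range q, φ i := by
  have hq' : (0 : ℤ) < q := by exact_mod_cast hq
  have hnn : ∀ j : ℕ, 0 ≤ (m + j * p) % q := fun j => Int.emod_nonneg _ hq'.ne'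
  have hlt : ∀ j : ℕ, (m + j * p) % q < q := fun j => Int.emod_lt_of_pos _ hq'
  have hmaps : ∀ j ∈ Finset.range q, ((m + j * p) % q).toNat ∈ Finset.range q := by
    intro j _
    rw [Finset.mem_range, Int.toNat_lt (hnn j)]
    exact hlt j
  have hinj : Set.InjOn (fun j : ℕ => ((m + j * p) % q).toNat) (Finset.range q) := by
    intro j hj j' hj' h
    simp only [Finset.coe_range, Set.mem_Iio] at hj hj'
    have h1 : (m + j * p) % q = (m + j' * p) % q := by
      have := congrArg (fun n : ℕ => (n : ℤ)) h
      simpa only [Int.toNat_of_nonneg (hnn j), Int.toNat_of_nonneg (hnn j')] using this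
    have h2 : (q : ℤ) ∣ (m + j' * p) - (m + j * p) := (Int.modEq_iff_dvd).1 h1
    have h3 : (q : ℤ) ∣ ((j' : ℤ) - j) * p := by
      convert h2 using 1
      ring
    have h4 : (q : ℤ) ∣ (j' : ℤ) - j := hcop.symm.dvd_of_dvd_mul_right h3
    have h5 := Int.eq_zero_of_abs_lt_dvd h4 (by rw [abs_lt]; constructor <;> omega)
    omega
  have hsurj := Finset.surjOn_of_injOn_of_card_le (fun j : ℕ => ((m + j * p) % q).toNat)
    (s := Finset.range q) (t := Finset.range q) hmaps hinj le_rfl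
  exact Finset.sum_nbij _ hmaps hinj hsurj fun _ _ => rfl

/-- A Denjoy–Koksma inequality for the sawtooth function. -/
theorem abs_sawSum_le {α : ℝ} {q : ℕ} (hq : 0 < q) {p : ℤ} (hcop : IsCoprime p q)
    (h : |q * α - p| ≤ 1 / q) (x : UnitAddCircle) : |sawSum α q x| ≤ 4 := by
  induction x using QuotientAddGroup.induction_on with
  | H t =>
  have hq' : (0 : ℝ) < q := Nat.cast_pos.2 hq
  set m : ℤ := ⌊q * t⌋ with hm
  set θ : ℝ := Int.fract (q * t) with hθ
  have hmθ : (m : ℝ) + θ = q * t := Int.floor_add_fract _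
  have hθ0 : 0 ≤ θ := Int.fract_nonneg _
  have hθ1 : θ < 1 := Int.fract_lt_one _
  set I : ℕ → ℕ := fun j => ((m + j * p) % q).toNat with hI
  set z : ℕ → ℝ := fun i => (i + θ) / q with hz
  set χ : ℕ → ℝ := fun i => (if i = 0 then 1 else 0) + if i = q - 1 then 1 else 0 with hχ
  have hqz : (0 : ℤ) < q := by exact_mod_cast hq
  have hIcast : ∀ j, ((I j : ℕ) : ℤ) = (m + j * p) % q := fun j =>
    Int.toNat_of_nonneg (Int.emod_nonneg _ hqz.ne')
  have hIlt : ∀ j, I j < q := fun j => by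
    have := Int.emod_lt_of_pos (m + j * p) hqz
    rw [← hIcast] at this
    exact_mod_cast this
  have hterm : ∀ j ∈ Finset.range q,
      |sawtooth ((t : UnitAddCircle) + ((j * α : ℝ) : UnitAddCircle)) - (z (I j) - 1 / 2)| ≤
        1 / q + χ (I j) := by
    intro j hj
    have hjq : (j : ℝ) ≤ q := by exact_mod_cast (Finset.mem_range.1 hj).le
    have hdiv : (m : ℝ) + j * p = I j + q * ((m + j * p) / q : ℤ) := by
      have := Int.emod_add_mul_ediv (m + j * p) q
      rw [← hIcast] at this
      exact_mod_cast this.symm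
    -- Replacing `α` by `p/q` puts the orbit on a translate of the lattice of step `1/q`, with error
    -- `j (qα - p)/q` at time `j`. As `p` is prime to `q`, each lattice point is met once.
    have e : t + j * α = z (I j) + j * (q * α - p) / q + ((m + j * p) / q : ℤ) := by
      have : t = (m + θ) / q := by rw [hmθ]; field_simp
      rw [this]
      simp only [hz]
      field_simp
      linear_combination hdiv
    rw [← AddCircle.coe_add, sawtooth_coe, e, Int.fract_add_intCast]
    have hδ : |(j : ℝ) * (q * α - p) / q| ≤ 1 / q := by
      rw [mul_div_right_comm, abs_mul, abs_of_nonneg (by positivity)]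
      calc (j : ℝ) / q * |q * α - p| ≤ 1 * (1 / q) :=
            mul_le_mul ((div_le_one hq').2 hjq) h (abs_nonneg _) zero_le_one
        _ = 1 / q := one_mul _
    have := abs_fract_add_sub_le hq (hIlt j) hθ0 hθ1 hδ
    convert this using 2
    ring
  have hs1 : ∑ j ∈ Finset.range q, (z (I j) - 1 / 2) = θ - 1 / 2 := by
    rw [sum_emod_eq hq hcop m fun i => z i - 1 / 2]
    have hgen : ∀ n : ℕ, ∑ i ∈ Finset.range n, (z i - 1 / 2) =
        (n * (n - 1) / 2 + n * θ) / q - n / 2 := by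
      intro n
      induction n with
      | zero => simp
      | succ n ih =>
        rw [Finset.sum_range_succ, ih, hz]
        push_cast
        field_simp
        ring
    rw [hgen]
    field_simp
    ring
  -- The `q` terms `1/q` contribute `1`, and the two extreme intervals `1` each.
  have hs2 : ∑ j ∈ Finset.range q, (1 / q + χ (I j)) ≤ 3 := by
    rw [Finset.sum_add_distrib, sum_emod_eq hq hcop m χ, Finset.sum_const, Finset.card_range,
      nsmul_eq_mul, mul_one_div_cancel hq'.ne', hχ, Finset.sum_add_distrib,
      Finset.sum_ite_eq', Finset.sum_ite_eq']
    split_ifs <;> norm_num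
  have hs3 : |sawSum α q t - (θ - 1 / 2)| ≤ 3 := by
    rw [← hs1, sawSum, ← Finset.sum_sub_distrib]
    exact (Finset.abs_sum_le_sum_abs _ _).trans ((Finset.sum_le_sum hterm).trans hs2)
  have h4 := abs_le.1 hs3
  change |sawSum α q (t : UnitAddCircle)| ≤ 4
  rw [abs_le]
  constructor <;> linarith

theorem norm_coe_unitAddCircle_le (t : ℝ) : ‖(t : UnitAddCircle)‖ ≤ |t| := by
  rw [UnitAddCircle.norm_eq]
  simpa using round_le t 0

/-- Translation by `σ δ` changes the sawtooth by `σ δ`, except on an arc of length `δ` where it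
wraps around and loses `σ`; `χ` is the indicator of that arc. -/
theorem sawtooth_add_sub_mem {δ σ : ℝ} (hδ0 : 0 ≤ δ) (hδ1 : δ < 1) (hσ : σ = 1 ∨ σ = -1) :
    ∃ χ : UnitAddCircle → ℝ, Measurable χ ∧ (∀ x, χ x = 0 ∨ χ x = 1) ∧
      (∀ x, sawtooth (x + ((σ * δ : ℝ) : UnitAddCircle)) - sawtooth x = σ * (δ - χ x)) ∧
      ∀ x y, χ x = 1 → χ y = 1 → ‖y - x‖ < δ := by
  set v : UnitAddCircle := ((σ * δ : ℝ) : UnitAddCircle) with hv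
  have hσσ : σ * σ = 1 := by rcases hσ with rfl | rfl <;> norm_num
  set χ : UnitAddCircle → ℝ := fun x => δ - σ * (sawtooth (x + v) - sawtooth x) with hχ
  -- The arc is `[1 - δ, 1)` for a positive translation and `[0, δ)` for a negative one.
  have hform : ∀ t ∈ Set.Ico (0 : ℝ) 1, (σ = 1 → χ t = if 1 - δ ≤ t then 1 else 0) ∧
      (σ = -1 → χ t = if t < δ then 1 else 0) := by
    rintro t ⟨ht0, ht1⟩
    have e : χ t = δ - σ * (Int.fract (t + σ * δ) - t) := by
      simp only [hχ, hv]
      rw [← AddCircle.coe_add, sawtooth_coe, sawtooth_coe, Int.fract_eq_self.2 ⟨ht0, ht1⟩]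
      ring
    constructor
    · rintro rfl
      rw [e]
      split_ifs with h
      · rw [show t + 1 * δ = (t + δ - 1) + 1 by ring, Int.fract_add_one,
          Int.fract_eq_self.2 ⟨by linarith, by linarith⟩]
        ring
      · rw [Int.fract_eq_self.2 ⟨by linarith, by push Not at h; linarith⟩]
        ring
    · rintro rfl
      rw [e]
      split_ifs with h
      · rw [show t + -1 * δ = (t - δ + 1) - 1 by ring, Int.fract_sub_one,
          Int.fract_eq_self.2 ⟨by linarith, by linarith⟩]
        ring
      · rw [Int.fract_eq_self.2 ⟨by push Not at h; linarith, by linarith⟩]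
        ring
  refine ⟨χ, ?_, fun x => ?_, fun x => ?_, fun x y hx hy => ?_⟩
  · exact ((measurable_sawtooth.comp (measurable_add_const _)).sub
      measurable_sawtooth).const_mul σ |>.const_sub δ
  · obtain ⟨t, ht, rfl⟩ := AddCircle.eq_coe_Ico x
    rcases hσ with h | h
    · rw [(hform t ht).1 h]; split_ifs <;> simp
    · rw [(hform t ht).2 h]; split_ifs <;> simp
  · simp only [hχ]
    linear_combination (-(sawtooth (x + v) - sawtooth x)) * hσσ
  · obtain ⟨t, ht, rfl⟩ := AddCircle.eq_coe_Ico x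
    obtain ⟨s, hs, rfl⟩ := AddCircle.eq_coe_Ico y
    rw [← AddCircle.coe_sub]
    refine (norm_coe_unitAddCircle_le _).trans_lt ?_
    rcases hσ with h | h
    · rw [(hform t ht).1 h] at hx
      rw [(hform s hs).1 h] at hy
      have hx' : 1 - δ ≤ t := by
        by_contra hn
        rw [if_neg hn] at hx
        exact zero_ne_one hx
      have hy' : 1 - δ ≤ s := by
        by_contra hn
        rw [if_neg hn] at hy
        exact zero_ne_one hy
      rw [abs_lt]
      constructor <;> linarith [ht.1, ht.2, hs.1, hs.2]
    · rw [(hform t ht).2 h] at hx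
      rw [(hform s hs).2 h] at hy
      have hx' : t < δ := by
        by_contra hn
        rw [if_neg hn] at hx
        exact zero_ne_one hx
      have hy' : s < δ := by
        by_contra hn
        rw [if_neg hn] at hy
        exact zero_ne_one hy
      rw [abs_lt]
      constructor <;> linarith [ht.1, ht.2, hs.1, hs.2]

/-- Summing over the orbit gives `σ (qδ - N)`, where `N` counts visits to the wrapping arc. By
separation there is at most one visit, so `N` is a Bernoulli variable of mean `qδ`, and the result
is its third central moment up to sign. -/
theorem integral_sawSum_sub_pow_three {α δ σ : ℝ} {q : ℕ} (hδ0 : 0 ≤ δ) (hδ1 : δ < 1)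
    (hσ : σ = 1 ∨ σ = -1) {v : UnitAddCircle} (hv : v = ((σ * δ : ℝ) : UnitAddCircle))
    (hsep : ∀ j : ℕ, 0 < j → j < q → δ ≤ ‖((j * α : ℝ) : UnitAddCircle)‖) :
    ∫ x, (sawSum α q (x + v) - sawSum α q x) ^ 3 =
      σ * ((q * δ) * (1 - q * δ) * (2 * (q * δ) - 1)) := by
  obtain ⟨χ, hχm, hχ01, hχ, hχsep⟩ := sawtooth_add_sub_mem hδ0 hδ1 hσ
  set N : UnitAddCircle → ℝ :=
    fun x => ∑ j ∈ Finset.range q, χ (x + ((j * α : ℝ) : UnitAddCircle)) with hN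
  have hσσ : σ * σ = 1 := by rcases hσ with rfl | rfl <;> norm_num
  have hD : ∀ x, sawSum α q (x + v) - sawSum α q x = σ * (q * δ - N x) := by
    intro x
    rw [sawSum, sawSum, ← Finset.sum_sub_distrib]
    have : ∀ j ∈ Finset.range q, sawtooth (x + v + ((j * α : ℝ) : UnitAddCircle)) -
        sawtooth (x + ((j * α : ℝ) : UnitAddCircle)) =
        σ * δ - σ * χ (x + ((j * α : ℝ) : UnitAddCircle)) := by
      intro j _
      rw [add_right_comm, hv, hχ]
      ring
    rw [Finset.sum_congr rfl this, Finset.sum_sub_distrib]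
    simp only [Finset.sum_const, Finset.card_range, nsmul_eq_mul, hN]
    rw [mul_sub, Finset.mul_sum]
    ring
  have hχabs : ∀ x, |χ x| ≤ 1 := fun x => by rcases hχ01 x with h | h <;> rw [h] <;> norm_num
  have hNm : Measurable N := Finset.measurable_fun_sum _ fun _ _ =>
    hχm.comp (measurable_add_const _)
  have hNB : ∀ x, |N x| ≤ q := by
    intro x
    refine (Finset.abs_sum_le_sum_abs _ _).trans
      ((Finset.sum_le_sum fun j _ => hχabs _).trans ?_)
    simp
  have hNi : Integrable N := integrable_of_measurable_of_abs_le hNm hNB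
  have hSi : Integrable (sawSum α q) := by
    refine integrable_of_measurable_of_abs_le (B := q * (1 / 2)) (measurable_sawSum α q) fun x => ?_
    refine (Finset.abs_sum_le_sum_abs _ _).trans
      ((Finset.sum_le_sum fun j _ => abs_sawtooth_le _).trans ?_)
    simp
  -- Cross terms vanish: visits at times `i < j` would give `‖(j - i) α‖ < δ`.
  have hNsq : ∀ x, N x * N x = N x := by
    intro x
    simp only [hN]
    rw [Finset.sum_mul_sum]
    refine Finset.sum_congr rfl fun i hi => ?_
    have hoff : ∀ j ∈ Finset.range q, j ≠ i → χ (x + ((i * α : ℝ) : UnitAddCircle)) *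
        χ (x + ((j * α : ℝ) : UnitAddCircle)) = 0 := by
      intro j hj hne
      rcases hχ01 (x + ((i * α : ℝ) : UnitAddCircle)) with h1 | h1
      · rw [h1, zero_mul]
      rcases hχ01 (x + ((j * α : ℝ) : UnitAddCircle)) with h2 | h2
      · rw [h2, mul_zero]
      exfalso
      rw [Finset.mem_range] at hi hj
      have hdiff : ∀ i j : ℕ, x + ((j * α : ℝ) : UnitAddCircle) - (x + ((i * α : ℝ) : UnitAddCircle)) =
          (((j - i) * α : ℝ) : UnitAddCircle) := by
        intro i j
        rw [add_sub_add_left_eq_sub, ← AddCircle.coe_sub, sub_mul]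
      have key : ∀ i j : ℕ, i < j → j < q → χ (x + ((i * α : ℝ) : UnitAddCircle)) = 1 →
          χ (x + ((j * α : ℝ) : UnitAddCircle)) = 1 → False := by
        intro i j hij hjq h1 h2
        have h3 := hsep (j - i) (by omega) (by omega)
        rw [Nat.cast_sub hij.le, ← hdiff] at h3
        exact h3.not_gt (hχsep _ _ h1 h2)
      rcases lt_or_gt_of_ne hne with h | h
      · exact key j i h hi h2 h1
      · exact key i j h hj h1 h2
    rw [Finset.sum_eq_single_of_mem i hi hoff]
    rcases hχ01 (x + ((i * α : ℝ) : UnitAddCircle)) with h1 | h1 <;> rw [h1] <;> norm_num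
  have hI0 : ∫ x, (sawSum α q (x + v) - sawSum α q x) = 0 := by
    rw [integral_sub (hSi.comp_add_right v) hSi,
      integral_add_right_eq_self (sawSum α q) v, sub_self]
  -- The mean of `N` is read off from the zero mean of the difference, without computing the length
  -- of the arc.
  have hNI : ∫ x, N x = q * δ := by
    simp only [hD] at hI0
    rw [integral_const_mul, integral_sub (integrable_const _) hNi] at hI0
    have hσ0 : σ ≠ 0 := by rintro rfl; norm_num at hσσ
    have h := (mul_eq_zero.1 hI0).resolve_left hσ0
    simp only [integral_const, probReal_univ, one_smul] at h
    linarith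
  have hcube : ∀ x, (sawSum α q (x + v) - sawSum α q x) ^ 3 =
      σ * (q * δ) ^ 3 + σ * (-3 * (q * δ) ^ 2 + 3 * (q * δ) - 1) * N x := by
    intro x
    rw [hD]
    have h := hNsq x
    linear_combination (σ * (q * δ - N x) ^ 3) * hσσ + σ * (3 * (q * δ) - 1 - N x) * h
  simp only [hcube]
  rw [integral_add (integrable_const _) (hNi.const_mul _), integral_const_mul _ N, hNI]
  simp only [integral_const, probReal_univ, one_smul]
  ring

end Sawtooth

/-! ### Sawtooth sums along convergent denominators -/

section ConvergentRotation

variable {α : ℝ} {p q : ℕ → ℤ}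

theorem distNearestInt_eq_norm (x : ℝ) : distNearestInt x = ‖(x : UnitAddCircle)‖ :=
  UnitAddCircle.norm_eq.symm

theorem coe_unitAddCircle_intCast (n : ℤ) : ((n : ℝ) : UnitAddCircle) = 0 :=
  AddCircle.coe_eq_zero_iff _ |>.2 ⟨n, by simp⟩

theorem coe_sub_intCast (t : ℝ) (n : ℤ) : ((t - n : ℝ) : UnitAddCircle) = t := by
  rw [AddCircle.coe_sub, coe_unitAddCircle_intCast, sub_zero]

namespace IsConvergentSeq

/-- From index `2` on, `q_{k+1} ≥ 2`, so that `p_k` is a nearest integer to `q_k α`. This is why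
small indices are excluded below. -/
theorem abs_le_half (H : IsConvergentSeq α p q) {k : ℕ} (hk : 2 ≤ k) :
    |q k * α - p k| ≤ 1 / 2 := by
  have h1 : (2 : ℝ) ≤ q (k + 1) := by
    have := H.nat_le k
    exact_mod_cast (by omega : (2 : ℤ) ≤ q (k + 1))
  exact (H.abs_le_one_div k).trans (one_div_le_one_div_of_le two_pos h1)

theorem distNearestInt_eq (H : IsConvergentSeq α p q) {k : ℕ} (hk : 2 ≤ k) :
    distNearestInt (q k * α) = |q k * α - p k| := by
  rw [distNearestInt_eq_norm, ← coe_sub_intCast _ (p k)]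
  exact (AddCircle.norm_coe_eq_abs_iff (1 : ℝ) one_ne_zero).2 (by simpa using H.abs_le_half hk)

theorem isCoprime (H : IsConvergentSeq α p q) (k : ℕ) : IsCoprime (p k) (q k) := by
  refine ⟨(-1) ^ (k + 1) * q (k + 1), -(-1) ^ (k + 1) * p (k + 1), ?_⟩
  have h : ((-1 : ℤ) ^ (k + 1)) * (-1) ^ (k + 1) = 1 := by rw [← mul_pow]; norm_num
  linear_combination (-1) ^ (k + 1) * H.det k + h

theorem abs_le_one_div_self (H : IsConvergentSeq α p q) (k : ℕ) :
    |q k * α - p k| ≤ 1 / q k :=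
  (H.abs_le_one_div k).trans
    (one_div_le_one_div_of_le (H.q_pos k) (by exact_mod_cast H.le_succ k))

theorem abs_le_norm_of_lt (H : IsConvergentSeq α p q) (k : ℕ) {j : ℕ} (hj0 : 0 < j)
    (hj : (j : ℤ) < q (k + 1)) :
    |q (k + 1) * α - p (k + 1)| ≤ ‖((j * α : ℝ) : UnitAddCircle)‖ := by
  refine (H.abs_succ_le k).trans ?_
  rw [UnitAddCircle.norm_eq]
  simpa using H.abs_le_abs_of_lt k (j := j) (by exact_mod_cast hj0) hj (round ((j : ℝ) * α))

end IsConvergentSeq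

theorem exists_cfDenom_spec (hα : Irrational α) :
    ∃ Q : ℕ → ℕ, (∀ k, cfDenom α k = Q k) ∧ (∀ k x, |sawSum α (Q k) x| ≤ 4) ∧
      Tendsto (fun k => ((Q k * α : ℝ) : UnitAddCircle)) atTop (𝓝 0) ∧
      ∀ᶠ k in atTop,
        |∫ x, (sawSum α (Q k) (x + ((Q k * α : ℝ) : UnitAddCircle)) - sawSum α (Q k) x) ^ 3| =
          |(cfDenom α k * distNearestInt (cfDenom α k * α)) *
            (1 - cfDenom α k * distNearestInt (cfDenom α k * α)) *
            (2 * (cfDenom α k * distNearestInt (cfDenom α k * α)) - 1)| := by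
  obtain ⟨p, q, hq, H⟩ := exists_convergentSeq hα
  have hcast : ∀ k, (((q k).toNat : ℕ) : ℤ) = q k := fun k =>
    Int.toNat_of_nonneg (zero_le_one.trans (H.one_le k))
  have hcastR : ∀ k, (((q k).toNat : ℕ) : ℝ) = q k := fun k => by
    exact_mod_cast congrArg (fun z : ℤ => (z : ℝ)) (hcast k)
  refine ⟨fun k => (q k).toNat, fun k => by rw [hq, hcastR], fun k x => ?_, ?_, ?_⟩
  · refine abs_sawSum_le (p := p k) ?_ ?_ ?_ x
    · have := H.one_le k
      change 0 < (q k).toNat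
      omega
    · rw [hcast]; exact H.isCoprime k
    · rw [hcastR]; exact H.abs_le_one_div_self k
  · simp only [hcastR]
    refine squeeze_zero_norm' (a := fun k : ℕ => 1 / (k : ℝ)) ?_ tendsto_one_div_atTop_nhds_zero_nat
    filter_upwards [eventually_ge_atTop 2] with k hk
    rw [← distNearestInt_eq_norm, H.distNearestInt_eq hk]
    refine (H.abs_le_one_div k).trans (one_div_le_one_div_of_le ?_ ?_)
    · exact_mod_cast (by omega : 0 < k)
    · exact_mod_cast H.nat_le k
  · filter_upwards [eventually_ge_atTop 2] with k hk
    -- Separation of the orbit up to time `q_{k+1}` comes from best approximation by the preceding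
    -- denominator `q_k`.
    obtain ⟨k, rfl⟩ : ∃ l, k = l + 1 := ⟨k - 1, by omega⟩
    rw [hq, H.distNearestInt_eq hk, hcastR]
    set D : ℝ := q (k + 1) * α - p (k + 1) with hD
    obtain ⟨σ, hσ, hσD⟩ : ∃ σ : ℝ, (σ = 1 ∨ σ = -1) ∧ σ * |D| = D := by
      rcases le_total 0 D with h | h
      · exact ⟨1, Or.inl rfl, by rw [abs_of_nonneg h, one_mul]⟩
      · exact ⟨-1, Or.inr rfl, by rw [abs_of_nonpos h]; ring⟩
    have h := integral_sawSum_sub_pow_three (α := α) (δ := |D|) (σ := σ)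
      (q := (q (k + 1)).toNat) (v := ((q (k + 1) * α : ℝ) : UnitAddCircle)) (abs_nonneg D)
      ((H.abs_le_half hk).trans_lt (by norm_num)) hσ
      (by rw [hσD, hD, coe_sub_intCast])
      (fun j hj0 hj => H.abs_le_norm_of_lt k hj0 (by omega))
    rw [h, hcastR, abs_mul]
    rcases hσ with rfl | rfl <;> simp

theorem cfDenom_mul_add_mul (hα : Irrational α) {k : ℕ} (hk : 2 ≤ k) :
    cfDenom α (k + 1) * distNearestInt (cfDenom α k * α) +
      cfDenom α k * distNearestInt (cfDenom α (k + 1) * α) = 1 := by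
  obtain ⟨p, q, hq, H⟩ := exists_convergentSeq hα
  rw [hq, hq, H.distNearestInt_eq hk, H.distNearestInt_eq (by omega)]
  linarith [H.abs_mul_add_abs_mul k]

theorem cfDenom_le_succ (hα : Irrational α) (k : ℕ) :
    0 < cfDenom α k ∧ cfDenom α k ≤ cfDenom α (k + 1) := by
  obtain ⟨p, q, hq, H⟩ := exists_convergentSeq hα
  rw [hq, hq]
  exact ⟨H.q_pos k, by exact_mod_cast H.le_succ k⟩

end ConvergentRotation

/-! ### Triple correlations under time reversal -/

section TripleCorrelation

variable {X : Type*} [MeasurableSpace X] {T : Equiv.Perm X} {f : X → ℝ} {c C : ℝ}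
  {μ : Measure X} {F G H : SpecialSpace f → ℝ}

/-- The triple correlation of `F`, `G`, `H` at times `0`, `s`, `w` along the special flow. -/
noncomputable def tripleCorr (μ : Measure X) (T : Equiv.Perm X) (F G H : SpecialSpace f → ℝ)
    (s w : ℝ) : ℝ :=
  ∫ p, F p * G (specialFlow T f s p) * H (specialFlow T f w p) ∂specialMeasure μ f

/-- A measure-preserving map which reverses the special flow reverses the triple correlations. -/
theorem tripleCorr_comp_of_reversing [IsFiniteMeasure μ] (hc : 0 < c) (hf : ∀ x, c ≤ f x)
    (hC : ∀ x, f x ≤ C) (hT : MeasurePreserving T μ μ) (hT' : Measurable T.symm)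
    (hfm : Measurable f) {φ : SpecialSpace f → SpecialSpace f}
    (hφ : MeasurePreserving φ (specialMeasure μ f) (specialMeasure μ f))
    (hφT : ∀ t : ℝ, ∀ᵐ p ∂specialMeasure μ f,
      φ (specialFlow T f t p) = specialFlow T f (-t) (φ p))
    (hF : Measurable F) (hG : Measurable G) (hH : Measurable H) {B : ℝ} (hFB : ∀ p, |F p| ≤ B)
    (hGB : ∀ p, |G p| ≤ B) (hHB : ∀ p, |H p| ≤ B) (s w : ℝ) :
    tripleCorr μ T (F ∘ φ) (G ∘ φ) (H ∘ φ) s w = tripleCorr μ T H G F (w - s) w := by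
  have hm := measurable_specialFlow hc hf hT.measurable hT' hfm
  have hmeas : Measurable fun p => F p * G (specialFlow T f (-s) p) *
      H (specialFlow T f (-w) p) := (hF.mul (hG.comp (hm _))).mul (hH.comp (hm _))
  have h1 : tripleCorr μ T (F ∘ φ) (G ∘ φ) (H ∘ φ) s w =
      ∫ p, F p * G (specialFlow T f (-s) p) * H (specialFlow T f (-w) p)
        ∂specialMeasure μ f := by
    conv_rhs => rw [← hφ.map_eq]
    rw [integral_map hφ.measurable.aemeasurable hmeas.aestronglyMeasurable]
    refine integral_congr_ae ?_
    filter_upwards [hφT s, hφT w] with p hs hw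
    simp only [Function.comp_apply, hs, hw]
  have hbound : ∀ p, |F p * G (specialFlow T f (-s) p) * H (specialFlow T f (-w) p)| ≤
      B * B * B := by
    intro p
    have hB0 := (abs_nonneg _).trans (hFB p)
    rw [abs_mul, abs_mul]
    exact mul_le_mul (mul_le_mul (hFB _) (hGB _) (abs_nonneg _) hB0) (hHB _) (abs_nonneg _)
      (mul_nonneg hB0 hB0)
  -- Moving the base point by time `w` turns the times `0, -s, -w` into `w, w - s, 0`.
  rw [h1, ← integral_comp_specialFlow hc hf hC hT hT' hfm hmeas hbound w]
  refine integral_congr_ae (Eventually.of_forall fun p => ?_)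
  simp only [specialFlow_specialFlow hc hf, add_neg_cancel, specialFlow_zero hc hf,
    ← sub_eq_add_neg]
  ring

end TripleCorrelation

/-! ### Test functions supported on a flow box -/

section FlowBox

variable {X : Type*} {T : Equiv.Perm X} {f : X → ℝ} {c R : ℝ} {J : Set X} {N : ℕ} {γ : ℝ → ℝ}

/-- The function on the special space which on the flow box over `J` is the function `γ` of the
vertical coordinate. -/
noncomputable def flowBoxFun (T : Equiv.Perm X) (f : X → ℝ) (J : Set X) (N : ℕ) (γ : ℝ → ℝ)
    (p : SpecialSpace f) : ℝ :=
  ∑ n ∈ Finset.Icc (-N : ℤ) N,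
    J.indicator 1 ((T ^ n) p.1.1) * γ (p.1.2 - cocycleSum T f n p.1.1)

/-- Within time `R` the orbit passes at most `N` times through the base, so the sum contains the
term that leads back to `x`. Every other term lands in an iterate of `J` of nonzero order at most
`2N`, disjoint from `J`. -/
theorem flowBoxFun_specialProj (hf0 : ∀ x, 0 < f x) (hc : 0 < c) (hf : ∀ x, c ≤ f x)
    (hN : R < N * c)
    (hJ : ∀ k : ℤ, k ≠ 0 → |k| ≤ 2 * N → ∀ x ∈ J, (T ^ k) x ∉ J) {x : X} (hx : x ∈ J) {r : ℝ}
    (hr : |r| ≤ R) : flowBoxFun T f J N γ (specialProj T f hf0 (x, r)) = γ r := by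
  obtain ⟨m, h1, h2⟩ := exists_cocycleSum_le_lt (T := T) hc hf x r
  have hmono := cocycleSum_strictMono (T := T) hc hf x
  have hr' := abs_le.1 hr
  have hm1 : m < N := by
    refine hmono.lt_iff_lt.1 (h1.trans_lt ?_)
    have := mul_le_cocycleSum (T := T) hf N x
    linarith
  have hm2 : -(N : ℤ) < m + 1 := by
    refine hmono.lt_iff_lt.1 (LE.le.trans_lt ?_ h2)
    have := cocycleSum_neg_le (T := T) hf N x
    linarith
  have hval := specialProj_val (T := T) hf0 hc hf h1 h2
  have hterm : ∀ n : ℤ, J.indicator (1 : X → ℝ) ((T ^ n) (specialProj T f hf0 (x, r)).1.1) *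
      γ ((specialProj T f hf0 (x, r)).1.2 - cocycleSum T f n (specialProj T f hf0 (x, r)).1.1) =
      J.indicator 1 ((T ^ (m + n)) x) * γ (r - cocycleSum T f (m + n) x) := by
    intro n
    rw [hval, cocycleSum_add, ← Equiv.Perm.mul_apply, ← zpow_add, add_comm n m, sub_sub]
  unfold flowBoxFun
  simp only [hterm]
  rw [Finset.sum_eq_single_of_mem (-m) (Finset.mem_Icc.2 ⟨by omega, by omega⟩)]
  · simp [cocycleSum_zero, hx]
  · intro n hn hne
    rw [Finset.mem_Icc] at hn
    rw [Set.indicator_of_notMem (hJ (m + n) (by omega) (by rw [abs_le]; constructor <;> omega) x hx),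
      zero_mul]

theorem abs_flowBoxFun_le {B : ℝ} (hγ : ∀ r, |γ r| ≤ B) (p : SpecialSpace f) :
    |flowBoxFun T f J N γ p| ≤ (Finset.Icc (-N : ℤ) N).card * B := by
  refine (Finset.abs_sum_le_sum_abs _ _).trans
    ((Finset.sum_le_sum (g := fun _ => B) fun n _ => ?_).trans (by simp))
  have hB0 := (abs_nonneg _).trans (hγ 0)
  rw [abs_mul]
  by_cases h : (T ^ n) p.1.1 ∈ J
  · simpa [h] using hγ _
  · simpa [h] using hB0

theorem measurable_flowBoxFun [MeasurableSpace X] (hT : Measurable T) (hT' : Measurable T.symm)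
    (hfm : Measurable f) (hJm : MeasurableSet J) (hγ : Measurable γ) :
    Measurable (flowBoxFun T f J N γ) := by
  have h1 : Measurable fun p : SpecialSpace f => p.1.1 := measurable_fst.comp measurable_subtype_coe
  have h2 : Measurable fun p : SpecialSpace f => p.1.2 := measurable_snd.comp measurable_subtype_coe
  refine Finset.measurable_fun_sum _ fun n _ => ?_
  exact ((measurable_one.indicator hJm).comp ((measurable_zpow hT hT' n).comp h1)).mul
    (hγ.comp (h2.sub ((measurable_cocycleSum hT hT' hfm n).comp h1)))

/-- The indicator function of `J × [0, c)` on the special space. -/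
noncomputable def baseBox (f : X → ℝ) (J : Set X) (c : ℝ) (p : SpecialSpace f) : ℝ :=
  J.indicator 1 p.1.1 * (Set.Iio c).indicator 1 p.1.2

theorem abs_baseBox_le (p : SpecialSpace f) : |baseBox f J c p| ≤ 1 := by
  unfold baseBox
  by_cases h : p.1.1 ∈ J <;> by_cases h' : p.1.2 ∈ Set.Iio c <;>
    simp only [Set.indicator_of_mem, Set.indicator_of_notMem, h, h', not_false_iff] <;> norm_num

theorem measurable_baseBox [MeasurableSpace X] (hJm : MeasurableSet J) :
    Measurable (baseBox f J c) :=
  ((measurable_one.indicator hJm).comp (measurable_fst.comp measurable_subtype_coe)).mul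
    ((measurable_one.indicator measurableSet_Iio).comp
      (measurable_snd.comp measurable_subtype_coe))

/-- Starting in `J × [0, c)` and moving for time at most `M`, the orbit keeps the coordinates of the
flow box. The correlation is thus a one-dimensional integral that the choice of `γ`, `γ'` controls.
-/
theorem tripleCorr_flowBox [MeasurableSpace X] {μ : Measure X} [IsFiniteMeasure μ] {C : ℝ}
    {γ' : ℝ → ℝ} (hc : 0 < c) (hf : ∀ x, c ≤ f x) (hC : ∀ x, f x ≤ C)
    (hcC : c ≤ C) (hfm : Measurable f) (hJm : MeasurableSet J) (hN : R < N * c)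
    (hJ : ∀ k : ℤ, k ≠ 0 → |k| ≤ 2 * N → ∀ x ∈ J, (T ^ k) x ∉ J)
    {M s w : ℝ} (hs : |s| ≤ M) (hw : |w| ≤ M) (hR : c + M ≤ R) :
    tripleCorr μ T (baseBox f J c) (flowBoxFun T f J N γ) (flowBoxFun T f J N γ') (-s) (-w) =
      μ.real J * ∫ r in (0 : ℝ)..c, γ (r - s) * γ' (r - w) := by
  have hf0 : ∀ x, 0 < f x := fun x => hc.trans_le (hf x)
  have hs' := abs_le.1 hs
  have hw' := abs_le.1 hw
  rw [tripleCorr, integral_specialMeasure (T := T) hf0 hc hf hC hfm]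
  have e : ∀ z : X × ℝ, {z : X × ℝ | 0 ≤ z.2 ∧ z.2 < f z.1}.indicator (fun z =>
      baseBox f J c (specialProj T f hf0 z) *
        flowBoxFun T f J N γ (specialFlow T f (-s) (specialProj T f hf0 z)) *
        flowBoxFun T f J N γ' (specialFlow T f (-w) (specialProj T f hf0 z))) z =
      J.indicator 1 z.1 * (Set.Ico 0 c).indicator (fun r => γ (r - s) * γ' (r - w)) z.2 := by
    rintro ⟨x, r⟩
    by_cases hz : (x, r) ∈ {z : X × ℝ | 0 ≤ z.2 ∧ z.2 < f z.1}
    · rw [Set.indicator_of_mem hz]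
      have hcoe : specialProj T f hf0 (x, r) = ⟨(x, r), hz⟩ :=
        specialProj_coe hf0 hc hf ⟨(x, r), hz⟩
      have hb : baseBox f J c (specialProj T f hf0 (x, r)) =
          J.indicator 1 x * (Set.Iio c).indicator 1 r := by rw [hcoe]; rfl
      rw [hb, specialFlow_specialProj hf0 hc hf, specialFlow_specialProj hf0 hc hf]
      by_cases hx : x ∈ J
      · by_cases hr : r < c
        · have h0 : 0 ≤ r := hz.1
          rw [flowBoxFun_specialProj hf0 hc hf hN hJ hx
              (by rw [abs_le]; constructor <;> linarith),
            flowBoxFun_specialProj hf0 hc hf hN hJ hx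
              (by rw [abs_le]; constructor <;> linarith),
            Set.indicator_of_mem (show r ∈ Set.Iio c from hr),
            Set.indicator_of_mem (show r ∈ Set.Ico 0 c from ⟨h0, hr⟩)]
          simp only [Pi.one_apply, ← sub_eq_add_neg]
          ring
        · rw [Set.indicator_of_notMem (show r ∉ Set.Iio c from hr),
            Set.indicator_of_notMem (show r ∉ Set.Ico 0 c from fun h => hr h.2)]
          simp
      · simp [hx]
    · have hr : r ∉ Set.Ico 0 c := fun h => hz ⟨h.1, h.2.trans_le (hf x)⟩
      rw [Set.indicator_of_notMem hz, Set.indicator_of_notMem (a := r) hr, mul_zero]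
  simp only [e]
  rw [integral_prod_mul (fun x => J.indicator (1 : X → ℝ) x)
    (fun r => (Set.Ico 0 c).indicator (fun r => γ (r - s) * γ' (r - w)) r)]
  congr 1
  · exact integral_indicator_one hJm
  · rw [integral_indicator measurableSet_Ico, Measure.restrict_restrict measurableSet_Ico,
      Set.inter_eq_left.2, intervalIntegral.integral_of_le hc.le, integral_Ico_eq_integral_Ioo,
      integral_Ioc_eq_integral_Ioo]
    exact fun r hr => ⟨hr.1, hr.2.le.trans hcC⟩

end FlowBox

/-! ### The affine roof: correlations along convergent denominators -/

section AffineRoof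

variable {α c : ℝ}

theorem circleRotation_zpow_apply (α : ℝ) (n : ℤ) (x : UnitAddCircle) :
    (circleRotation α ^ n) x = x + ((n * α : ℝ) : UnitAddCircle) := by
  induction n using Int.induction_on with
  | zero => simp
  | succ n ih =>
    rw [add_comm (n : ℤ) 1, zpow_add, Equiv.Perm.mul_apply, ih, zpow_one, circleRotation,
      Equiv.coe_addRight]
    simp only
    rw [add_assoc, ← AddCircle.coe_add]
    congr 2
    push_cast
    ring
  | pred n ih =>
    rw [sub_eq_add_neg, add_comm (-(n : ℤ)) (-1), zpow_add, Equiv.Perm.mul_apply, ih, zpow_neg_one,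
      Equiv.Perm.inv_def, circleRotation, Equiv.addRight_symm, Equiv.coe_addRight]
    simp only
    rw [add_assoc, ← AddCircle.coe_neg, ← AddCircle.coe_add]
    congr 2
    push_cast
    ring

theorem measurePreserving_circleRotation (α : ℝ) :
    MeasurePreserving (circleRotation α) (volume : Measure UnitAddCircle) volume :=
  measurePreserving_add_right volume (α : UnitAddCircle)

theorem measurable_circleRotation_symm (α : ℝ) : Measurable (circleRotation α).symm :=
  measurable_add_const (-(α : UnitAddCircle))

theorem affineRoof_eq (c : ℝ) (x : UnitAddCircle) : affineRoof c x = sawtooth x + (c + 1 / 2) := by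
  rw [affineRoof, sawtooth]
  ring

theorem measurable_affineRoof (c : ℝ) : Measurable (affineRoof c) := by
  rw [funext (affineRoof_eq c)]
  exact measurable_sawtooth.add_const _

theorem le_affineRoof (c : ℝ) (x : UnitAddCircle) : c ≤ affineRoof c x := by
  rw [affineRoof_eq]
  linarith [(abs_le.1 (abs_sawtooth_le x)).1]

theorem affineRoof_le (c : ℝ) (x : UnitAddCircle) : affineRoof c x ≤ c + 1 := by
  rw [affineRoof_eq]
  linarith [(abs_le.1 (abs_sawtooth_le x)).2]

theorem cocycleSum_affineRoof (α c : ℝ) (q : ℕ) (x : UnitAddCircle) :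
    cocycleSum (circleRotation α) (affineRoof c) q x = sawSum α q x + q * (c + 1 / 2) := by
  change ∑ j ∈ Finset.range q, affineRoof c ((circleRotation α ^ (j : ℤ)) x) = _
  simp only [circleRotation_zpow_apply, affineRoof_eq, Finset.sum_add_distrib, Finset.sum_const,
    Finset.card_range, nsmul_eq_mul, sawSum, Int.cast_natCast]
  ring

theorem tendsto_sawtooth_add_sub {v : ℕ → UnitAddCircle} (hv : Tendsto v atTop (𝓝 0))
    {x : UnitAddCircle} (hx : x ≠ 0) :
    Tendsto (fun n => sawtooth (x + v n)) atTop (𝓝 (sawtooth x)) :=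
  (continuousAt_sawtooth hx).tendsto.comp (by simpa using hv.const_add x)

theorem ae_ne_zero_unitAddCircle : ∀ᵐ x : UnitAddCircle, x ≠ 0 := by
  have h : (volume : Measure UnitAddCircle) {0} = 0 := by
    rw [← Metric.closedBall_zero, AddCircle.volume_closedBall]
    simp
  exact compl_mem_ae_iff.2 h

/-- As `c + 1/2` is the mean of the roof, this large time acts as the rotation by `qα` together with
the vertical displacement `-sawSum α q x`. -/
theorem specialProj_add_mul (hf0 : ∀ x, 0 < affineRoof c x) (hc : 0 < c) (q : ℕ)
    (x : UnitAddCircle) (r : ℝ) :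
    specialProj (circleRotation α) (affineRoof c) hf0 (x, r + q * (c + 1 / 2)) =
      specialProj (circleRotation α) (affineRoof c) hf0
        (x + ((q * α : ℝ) : UnitAddCircle), r - sawSum α q x) := by
  have h := specialFlow_cocycleSum_shift (T := circleRotation α) hf0 hc (le_affineRoof c) x
    (r - sawSum α q x) q
  rw [cocycleSum_affineRoof, circleRotation_zpow_apply, Int.cast_natCast] at h
  rw [← h]
  congr 2
  ring

/-- Along times `q (c + 1/2)` with bounded Birkhoff sums and `q α → 0` the triple correlations
of the special flow are asymptotic to averaged triple correlations at bounded times. -/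
theorem tendsto_tripleCorr_sub_integral (hα : Irrational α) (hc : 0 < c) {q : ℕ → ℕ} {M : ℝ}
    (hM : ∀ n x, |sawSum α (q n) x| ≤ M)
    (hq : Tendsto (fun n => ((q n * α : ℝ) : UnitAddCircle)) atTop (𝓝 0))
    {F G H : SpecialSpace (affineRoof c) → ℝ} (hF : Measurable F) (hG : Measurable G)
    (hH : Measurable H) {B : ℝ} (hFB : ∀ p, |F p| ≤ B) (hGB : ∀ p, |G p| ≤ B)
    (hHB : ∀ p, |H p| ≤ B) :
    Tendsto (fun n => tripleCorr volume (circleRotation α) F G H (q n * (c + 1 / 2))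
        (2 * (q n * (c + 1 / 2))) -
      ∫ y, tripleCorr volume (circleRotation α) F G H (-sawSum α (q n) y)
        (-(sawSum α (q n) y + sawSum α (q n) (y + ((q n * α : ℝ) : UnitAddCircle))))) atTop
      (𝓝 0) := by
  have hf := le_affineRoof c
  have hC := affineRoof_le c
  have hfm := measurable_affineRoof c
  have hf0 : ∀ x, 0 < affineRoof c x := fun x => hc.trans_le (hf x)
  set v : ℕ → UnitAddCircle := fun n => ((q n * α : ℝ) : UnitAddCircle) with hv
  set S : ℕ → UnitAddCircle → ℝ := fun n => sawSum α (q n) with hS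
  set W : ℕ → UnitAddCircle → ℝ := fun n y => S n y + S n (y + v n) with hW
  have hπ := measurable_specialProj (T := circleRotation α) hf0 hc hf (measurePreserving_circleRotation α).measurable
    (measurable_circleRotation_symm α) hfm
  set a : UnitAddCircle × ℝ → ℝ := {z : UnitAddCircle × ℝ | 0 ≤ z.2 ∧ z.2 < affineRoof c z.1}.indicator
    fun z => F (specialProj (circleRotation α) (affineRoof c) hf0 z) with ha
  have ham : Measurable a := (hF.comp hπ).indicator (measurableSet_underGraph hfm)
  have haB : ∀ z, |a z| ≤ B := by
    intro z
    simp only [ha, Set.indicator]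
    split_ifs
    · exact hFB _
    · simpa using (abs_nonneg _).trans (hFB (specialProj (circleRotation α) (affineRoof c) hf0 z))
  have hSm : ∀ n, Measurable (S n) := fun n => measurable_sawSum α (q n)
  have hWm : ∀ n, Measurable (W n) := fun n =>
    (hSm n).add ((hSm n).comp (measurable_add_const _))
  have hSB : ∀ n x, |S n x| ≤ M + M := fun n x =>
    (hM n x).trans (by linarith [(abs_nonneg _).trans (hM n x)])
  have hWB : ∀ n x, |W n x| ≤ M + M := fun n x =>
    (abs_add_le _ _).trans (add_le_add (hM n _) (hM n _))
  have hvv : Tendsto (fun n => v n + v n) atTop (𝓝 0) := by simpa using hq.add hq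
  have hSinv : ∀ᵐ x, Tendsto (fun n => S n (x + α) - S n x) atTop (𝓝 0) := by
    filter_upwards [ae_ne_zero_unitAddCircle] with x hx
    simp only [hS, sawSum_add_self]
    simpa only [sub_self] using (tendsto_sawtooth_add_sub hq hx).sub_const (sawtooth x)
  have hWinv : ∀ᵐ x, Tendsto (fun n => W n (x + α) - W n x) atTop (𝓝 0) := by
    filter_upwards [ae_ne_zero_unitAddCircle, hSinv] with x hx hSx
    have h1 : Tendsto (fun n => S n (x + v n + α) - S n (x + v n)) atTop (𝓝 0) := by
      simp only [hS, sawSum_add_self]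
      have h2 := (tendsto_sawtooth_add_sub hvv hx).sub (tendsto_sawtooth_add_sub hq hx)
      simpa only [sub_self, ← add_assoc] using h2
    have h3 := hSx.add h1
    rw [add_zero] at h3
    refine h3.congr fun n => ?_
    simp only [hW, add_right_comm x (v n) (α : UnitAddCircle)]
    ring
  have hbdd : ∀ {Θ : SpecialSpace (affineRoof c) → ℝ}, Measurable Θ → (∀ p, |Θ p| ≤ B) →
      BddOnStrip (c + 1 + (M + M)) fun z => Θ (specialProj (circleRotation α) (affineRoof c) hf0 z) := fun hΘ hΘB =>
    ⟨hΘ.comp hπ, B, fun x r _ => hΘB _⟩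
  have hlim := tendsto_decouplingDefect (C := c + 1) hα ham haB hSm hWm hSB hWB le_rfl hSinv hWinv
    hq hvv (hbdd hG hGB) (hbdd hH hHB)
  refine hlim.congr fun n => ?_
  rw [decouplingDefect]
  congr 1
  -- The first trilinear integral is exactly the correlation at the long times: two successive moves
  -- shift the base by `2 v n` and the height by `-W n`.
  · rw [tripleCorr, integral_specialMeasure (T := circleRotation α) hf0 hc hf hC hfm, trilinearIntegral]
    congr 1
    funext z
    obtain ⟨x, r⟩ := z
    by_cases hz : (x, r) ∈ {z : UnitAddCircle × ℝ | 0 ≤ z.2 ∧ z.2 < affineRoof c z.1}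
    · rw [ha, Set.indicator_of_mem hz, Set.indicator_of_mem hz,
        specialFlow_specialProj hf0 hc hf, specialFlow_specialProj hf0 hc hf]
      have e1 := specialProj_add_mul (α := α) hf0 hc (q n) x r
      have e2 := specialProj_add_mul (α := α) hf0 hc (q n) x (r + q n * (c + 1 / 2))
      have e3 := specialProj_add_mul (α := α) hf0 hc (q n) (x + v n) (r - S n x)
      rw [show r + q n * (c + 1 / 2) + q n * (c + 1 / 2) = r + 2 * (q n * (c + 1 / 2)) by ring,
        show r + q n * (c + 1 / 2) - sawSum α (q n) x = r - S n x + q n * (c + 1 / 2) by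
          simp only [hS]; ring, e3] at e2
      rw [e1, e2]
      simp only [hW, hS, hv, sub_sub, add_assoc]
    · rw [ha, Set.indicator_of_notMem hz, Set.indicator_of_notMem hz, zero_mul, zero_mul]
  -- In the second one, Fubini isolates the independent variable `y`; for fixed `y` the shifts are
  -- constant and the inner integral is a correlation at bounded times.
  · have hi := integrable_trilinear (μ := (volume : Measure UnitAddCircle).prod
      (volume : Measure UnitAddCircle)) (C := c + 1) (a := fun z => a (z.1.1, z.2))
      (X₁ := Prod.fst) (X₂ := Prod.fst) (S := fun z => S n z.2) (W := fun z => W n z.2)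
      (ham.comp ((measurable_fst.comp measurable_fst).prodMk measurable_snd)) (fun z => haB _)
      measurable_fst measurable_fst ((hSm n).comp measurable_snd) ((hWm n).comp measurable_snd)
      (fun z => hSB n _) (fun z => hWB n _) le_rfl (hbdd hG hGB) (hbdd hH hHB)
    rw [trilinearIntegral, integral_prod _ hi, integral_prod_symm _ hi.integral_prod_left]
    congr 1
    funext y
    have hi2 := integrable_trilinear (μ := (volume : Measure UnitAddCircle)) (C := c + 1) (a := a)
      (X₁ := id) (X₂ := id) (S := fun _ => S n y) (W := fun _ => W n y) ham haB measurable_id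
      measurable_id measurable_const measurable_const
      (fun z => hSB n y) (fun z => hWB n y) le_rfl (hbdd hG hGB) (hbdd hH hHB)
    rw [tripleCorr, integral_specialMeasure (T := circleRotation α) hf0 hc hf hC hfm]
    refine ((integral_prod _ hi2).symm).trans ?_
    congr 1
    funext z
    obtain ⟨x, r⟩ := z
    by_cases hz : (x, r) ∈ {z : UnitAddCircle × ℝ | 0 ≤ z.2 ∧ z.2 < affineRoof c z.1}
    · rw [ha, Set.indicator_of_mem hz, Set.indicator_of_mem hz,
        specialFlow_specialProj hf0 hc hf, specialFlow_specialProj hf0 hc hf]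
      rfl
    · rw [ha, Set.indicator_of_notMem hz, Set.indicator_of_notMem hz, zero_mul, zero_mul]

end AffineRoof

/-! ### Vanishing of the third moment and the contradiction -/

section Conclusion

variable {α c : ℝ}

theorem exists_ball_disjoint_rotations (hα : Irrational α) (K : ℤ) :
    ∃ ρ > 0, ∀ k : ℤ, k ≠ 0 → |k| ≤ K → ∀ x ∈ Metric.ball (0 : UnitAddCircle) ρ,
      (circleRotation α ^ k) x ∉ Metric.ball (0 : UnitAddCircle) ρ := by
  have hne : ∀ k : ℤ, k ≠ 0 → 0 < ‖((k * α : ℝ) : UnitAddCircle)‖ := by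
    intro k hk
    rw [norm_pos_iff]
    intro h
    obtain ⟨n, hn⟩ := (AddCircle.coe_eq_zero_iff (1 : ℝ)).1 h
    exact (hα.intCast_mul hk).ne_int n (by simpa using hn.symm)
  have hev : ∀ᶠ ρ : ℝ in 𝓝[>] 0, ∀ k ∈ Finset.Icc (-K) K, k ≠ 0 →
      ρ + ρ < ‖((k * α : ℝ) : UnitAddCircle)‖ := by
    rw [Filter.eventually_all_finset]
    intro k _
    by_cases hk : k = 0
    · simp [hk]
    have ht : Tendsto (fun ρ : ℝ => ρ + ρ) (𝓝[>] 0) (𝓝 0) := by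
      have : Tendsto (fun ρ : ℝ => ρ + ρ) (𝓝 0) (𝓝 (0 + 0)) := tendsto_id.add tendsto_id
      rw [add_zero] at this
      exact this.mono_left nhdsWithin_le_nhds
    filter_upwards [ht.eventually_lt_const (hne k hk)] with ρ hρ _ using hρ
  obtain ⟨ρ, hρ, hρ0⟩ := (hev.and self_mem_nhdsWithin).exists
  refine ⟨ρ, hρ0, fun k hk hkK x hx hx' => ?_⟩
  rw [mem_ball_zero_iff] at hx hx'
  rw [circleRotation_zpow_apply] at hx'
  have h1 := hρ k (Finset.mem_Icc.2 (abs_le.1 hkK)) hk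
  have h2 := norm_sub_le (x + ((k * α : ℝ) : UnitAddCircle)) x
  rw [add_sub_cancel_left] at h2
  linarith

theorem integrable_continuous_comp_of_bounded {X : Type*} [MeasurableSpace X] {μ : Measure X}
    [IsFiniteMeasure μ] {P : ℝ × ℝ → ℝ} (hP : Continuous P) {S U : X → ℝ} (hS : Measurable S)
    (hU : Measurable U) {M : ℝ} (hSM : ∀ x, |S x| ≤ M) (hUM : ∀ x, |U x| ≤ M) :
    Integrable (fun x => P (S x, U x)) μ := by
  obtain ⟨B, hB⟩ := ((isCompact_Icc (a := -M) (b := M)).prod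
    (isCompact_Icc (a := -M) (b := M))).exists_bound_of_continuousOn hP.continuousOn
  exact integrable_of_measurable_of_abs_le (hP.measurable.comp (hS.prodMk hU))
    fun x => hB _ ⟨abs_le.1 (hSM x), abs_le.1 (hUM x)⟩

theorem integral_sub_mul_sub_sq (c s w : ℝ) :
    ∫ r in (0 : ℝ)..c, (r - s) * (r - w) ^ 2 =
      c ^ 4 / 4 - (s + 2 * w) * c ^ 3 / 3 + (2 * s * w + w ^ 2) * c ^ 2 / 2 - s * w ^ 2 * c := by
  have hd : ∀ r ∈ Set.uIcc 0 c, HasDerivAt (fun r : ℝ => r ^ 4 / 4 - (s + 2 * w) * r ^ 3 / 3 +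
      (2 * s * w + w ^ 2) * r ^ 2 / 2 - s * w ^ 2 * r) ((r - s) * (r - w) ^ 2) r := by
    intro r _
    have h := (((((hasDerivAt_id' r).pow 4).div_const 4).sub
      ((((hasDerivAt_id' r).pow 3).const_mul (s + 2 * w)).div_const 3)).add
      ((((hasDerivAt_id' r).pow 2).const_mul (2 * s * w + w ^ 2)).div_const 2)).sub
      ((hasDerivAt_id' r).const_mul (s * w ^ 2))
    refine h.congr_deriv ?_
    norm_num
    ring
  rw [intervalIntegral.integral_eq_sub_of_hasDerivAt hd
    ((by fun_prop : Continuous fun r : ℝ => (r - s) * (r - w) ^ 2).intervalIntegrable 0 c)]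
  ring

/-- The reversal exchanges `S` and `U` in the averaged correlations. As `U` is a translate of `S`,
differences `P(S) - P(U)` integrate to zero; these exhaust the antisymmetric polynomials of degree
at most two, so a cubic is the first that can detect the asymmetry. -/
theorem tendsto_integral_sawSum_sub_pow_three (hα : Irrational α) (hc : 0 < c) {q : ℕ → ℕ}
    {M : ℝ} (hM : ∀ n x, |sawSum α (q n) x| ≤ M)
    (hq : Tendsto (fun n => ((q n * α : ℝ) : UnitAddCircle)) atTop (𝓝 0))
    (hiso : IsomorphicToInverse (specialMeasure (volume : Measure UnitAddCircle) (affineRoof c))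
      (specialFlow (circleRotation α) (affineRoof c))) :
    Tendsto (fun n => ∫ x, (sawSum α (q n) (x + ((q n * α : ℝ) : UnitAddCircle)) -
      sawSum α (q n) x) ^ 3) atTop (𝓝 0) := by
  obtain ⟨φ, -, hφ, -, -, -, hφT⟩ := hiso
  have hM0 : 0 ≤ M := (abs_nonneg _).trans (hM 0 0)
  set R : ℝ := c + (M + M) with hR
  obtain ⟨N, hN⟩ := exists_nat_gt (R / c)
  rw [div_lt_iff₀ hc] at hN
  obtain ⟨ρ, hρ, hJ⟩ := exists_ball_disjoint_rotations hα (2 * N)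
  set J := Metric.ball (0 : UnitAddCircle) ρ with hJdef
  have hJm : MeasurableSet J := Metric.isOpen_ball.measurableSet
  have hJpos : 0 < (volume : Measure UnitAddCircle).real J :=
    ENNReal.toReal_pos (Metric.measure_ball_pos volume 0 hρ).ne' (measure_ne_top _ _)
  -- The profiles `r` and `r²` make the correlation a cubic in the times; truncation to `[-R, R]`
  -- keeps them bounded and is invisible at the times used.
  set γ₁ : ℝ → ℝ := (Set.Icc (-R) R).indicator fun r => r with hγ₁
  set γ₂ : ℝ → ℝ := (Set.Icc (-R) R).indicator fun r => r ^ 2 with hγ₂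
  have hR0 : 0 ≤ R := by positivity
  have hγ₁B : ∀ r, |γ₁ r| ≤ R + R ^ 2 := by
    intro r
    by_cases h : r ∈ Set.Icc (-R) R
    · rw [hγ₁, Set.indicator_of_mem h]
      linarith [abs_le.2 h, sq_nonneg R]
    · rw [hγ₁, Set.indicator_of_notMem h, abs_zero]
      positivity
  have hγ₂B : ∀ r, |γ₂ r| ≤ R + R ^ 2 := by
    intro r
    by_cases h : r ∈ Set.Icc (-R) R
    · rw [hγ₂, Set.indicator_of_mem h, abs_pow]
      linarith [pow_le_pow_left₀ (abs_nonneg r) (abs_le.2 h) 2]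
    · rw [hγ₂, Set.indicator_of_notMem h, abs_zero]
      positivity
  have hγ₁m : Measurable γ₁ := measurable_id.indicator measurableSet_Icc
  have hγ₂m : Measurable γ₂ := (measurable_id.pow_const 2).indicator measurableSet_Icc
  have hT := measurePreserving_circleRotation α
  have hT' := measurable_circleRotation_symm α
  have hf := le_affineRoof c
  have hC := affineRoof_le c
  have hfm := measurable_affineRoof c
  set H := baseBox (affineRoof c) J c with hH
  set G := flowBoxFun (circleRotation α) (affineRoof c) J N γ₁ with hG
  set F := flowBoxFun (circleRotation α) (affineRoof c) J N γ₂ with hF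
  set B : ℝ := (Finset.Icc (-N : ℤ) N).card * (R + R ^ 2) + 1 with hB
  have hHB : ∀ p, |H p| ≤ B := fun p => (abs_baseBox_le p).trans (by
    have : 0 ≤ (Finset.Icc (-N : ℤ) N).card * (R + R ^ 2) := by positivity
    linarith)
  have hGB : ∀ p, |G p| ≤ B := fun p => (abs_flowBoxFun_le hγ₁B p).trans (by linarith)
  have hFB : ∀ p, |F p| ≤ B := fun p => (abs_flowBoxFun_le hγ₂B p).trans (by linarith)
  have hHm : Measurable H := measurable_baseBox hJm
  have hGm : Measurable G := measurable_flowBoxFun hT.measurable hT' hfm hJm hγ₁m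
  have hFm : Measurable F := measurable_flowBoxFun hT.measurable hT' hfm hJm hγ₂m
  have hrev := tripleCorr_comp_of_reversing hc hf hC hT hT' hfm hφ hφT hFm hGm hHm hFB hGB hHB
  have hlim₁ := tendsto_tripleCorr_sub_integral hα hc hM hq (hFm.comp hφ.measurable)
    (hGm.comp hφ.measurable) (hHm.comp hφ.measurable) (fun p => hFB _) (fun p => hGB _)
    (fun p => hHB _)
  have hlim₂ := tendsto_tripleCorr_sub_integral hα hc hM hq hHm hGm hFm hHB hGB hFB
  simp only [hrev] at hlim₁
  set S : ℕ → UnitAddCircle → ℝ := fun n => sawSum α (q n) with hS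
  set U : ℕ → UnitAddCircle → ℝ :=
    fun n y => sawSum α (q n) (y + ((q n * α : ℝ) : UnitAddCircle)) with hU
  set m := (volume : Measure UnitAddCircle).real J with hm
  have hval : ∀ s w : ℝ, |s| ≤ M + M → |w| ≤ M + M →
      tripleCorr volume (circleRotation α) H G F (-s) (-w) =
        m * (c ^ 4 / 4 - (s + 2 * w) * c ^ 3 / 3 + (2 * s * w + w ^ 2) * c ^ 2 / 2 -
          s * w ^ 2 * c) := by
    intro s w hs hw
    rw [hH, hG, hF, tripleCorr_flowBox (C := c + 1) hc hf hC (by linarith) hfm hJm hN hJ hs hw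
      le_rfl, ← integral_sub_mul_sub_sq]
    congr 1
    refine intervalIntegral.integral_congr fun r hr => ?_
    rw [Set.uIcc_of_le hc.le] at hr
    have hs' := abs_le.1 hs
    have hw' := abs_le.1 hw
    have h1 : r - s ∈ Set.Icc (-R) R := ⟨by linarith [hr.1, hr.2], by linarith [hr.1, hr.2]⟩
    have h2 : r - w ∈ Set.Icc (-R) R := ⟨by linarith [hr.1, hr.2], by linarith [hr.1, hr.2]⟩
    simp only [hγ₁, hγ₂, Set.indicator_of_mem h1, Set.indicator_of_mem h2]
  have hSM : ∀ n y, |S n y| ≤ M + M := fun n y => (hM n y).trans (by linarith)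
  have hUM : ∀ n y, |U n y| ≤ M + M := fun n y => (hM n _).trans (by linarith)
  have hSUM : ∀ n y, |S n y + U n y| ≤ M + M := fun n y =>
    (abs_add_le _ _).trans (add_le_add (hM n y) (hM n _))
  have hSm : ∀ n, Measurable (S n) := fun n => measurable_sawSum α (q n)
  have hUm : ∀ n, Measurable (U n) := fun n => (hSm n).comp (measurable_add_const _)
  have hdiff : ∀ n,
      (∫ y, tripleCorr volume (circleRotation α) H G F (-(S n y + U n y) - -S n y)
        (-(S n y + U n y))) -
      (∫ y, tripleCorr volume (circleRotation α) H G F (-S n y) (-(S n y + U n y))) =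
      m * (c / 3) * ∫ y, (U n y - S n y) ^ 3 := by
    intro n
    set E : ℝ × ℝ → ℝ := fun z => m * (c ^ 4 / 4 - (z.1 + 2 * z.2) * c ^ 3 / 3 +
      (2 * z.1 * z.2 + z.2 ^ 2) * c ^ 2 / 2 - z.1 * z.2 ^ 2 * c) with hE
    have hEc : Continuous E := by fun_prop
    -- `P` collects the terms in `S` alone and in `U` alone that are left once `m (c / 3) (U - S)³`
    -- is taken out of the difference.
    set P : ℝ → ℝ := fun s => m * (s * c ^ 3 / 3 - c ^ 2 * s ^ 2 + 4 / 3 * c * s ^ 3) with hP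
    have hPc : Continuous P := by fun_prop
    have e1 : ∀ y, tripleCorr volume (circleRotation α) H G F (-(S n y + U n y) - -S n y)
        (-(S n y + U n y)) = E (U n y, S n y + U n y) := by
      intro y
      rw [show -(S n y + U n y) - -S n y = -U n y by ring, hval _ _ (hUM n y) (hSUM n y)]
    have e2 : ∀ y, tripleCorr volume (circleRotation α) H G F (-S n y) (-(S n y + U n y)) =
        E (S n y, S n y + U n y) := fun y => hval _ _ (hSM n y) (hSUM n y)
    simp only [e1, e2]
    have hSUm : Measurable fun y => S n y + U n y := (hSm n).add (hUm n)
    have hiS : Integrable fun y => P (S n y) :=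
      integrable_continuous_comp_of_bounded (P := fun z => P z.1) (hPc.comp continuous_fst)
        (hSm n) (hUm n) (hSM n) (hUM n)
    have hiU : Integrable fun y => P (U n y) :=
      integrable_continuous_comp_of_bounded (P := fun z => P z.2) (hPc.comp continuous_snd)
        (hSm n) (hUm n) (hSM n) (hUM n)
    have hi3 : Integrable fun y => (U n y - S n y) ^ 3 :=
      integrable_continuous_comp_of_bounded (P := fun z => (z.2 - z.1) ^ 3) (by fun_prop)
        (hSm n) (hUm n) (hSM n) (hUM n)
    rw [← integral_sub (integrable_continuous_comp_of_bounded hEc (hUm n) hSUm (hUM n) (hSUM n))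
      (integrable_continuous_comp_of_bounded hEc (hSm n) hSUm (hSM n) (hSUM n))]
    have e3 : ∀ y, E (U n y, S n y + U n y) - E (S n y, S n y + U n y) =
        m * (c / 3) * (U n y - S n y) ^ 3 + (P (S n y) - P (U n y)) := by
      intro y
      simp only [hE, hP]
      ring
    have e4 : ∫ y, P (U n y) = ∫ y, P (S n y) :=
      integral_add_right_eq_self (fun y => P (S n y)) ((q n * α : ℝ) : UnitAddCircle)
    simp only [e3]
    rw [integral_add (hi3.const_mul _)
      (show Integrable (fun y => P (S n y) - P (U n y)) from hiS.sub hiU), integral_sub hiS hiU, e4,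
      sub_self, add_zero, integral_const_mul]
  -- The long-time correlations agree, since `2s - s = s`, and cancel in the difference.
  have hlim := hlim₂.sub hlim₁
  have hlim' : Tendsto (fun n => m * (c / 3) * ∫ y, (U n y - S n y) ^ 3) atTop (𝓝 0) := by
    rw [sub_zero] at hlim
    refine hlim.congr fun n => ?_
    rw [← hdiff, show 2 * ((q n : ℝ) * (c + 1 / 2)) - q n * (c + 1 / 2) = q n * (c + 1 / 2) by ring]
    ring
  have hmc : m * (c / 3) ≠ 0 := (mul_pos hJpos (by positivity)).ne'
  have := hlim'.const_mul (m * (c / 3))⁻¹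
  simpa only [inv_mul_cancel_left₀ hmc, mul_zero] using this

theorem tendsto_of_isomorphicToInverse (hα : Irrational α) (hc : 0 < c)
    (hiso : IsomorphicToInverse (specialMeasure (volume : Measure UnitAddCircle) (affineRoof c))
      (specialFlow (circleRotation α) (affineRoof c))) :
    Tendsto (fun k => (cfDenom α k * distNearestInt (cfDenom α k * α)) *
      (1 - cfDenom α k * distNearestInt (cfDenom α k * α)) *
      (2 * (cfDenom α k * distNearestInt (cfDenom α k * α)) - 1)) atTop (𝓝 0) := by
  obtain ⟨Q, -, hM, hq, hev⟩ := exists_cfDenom_spec hα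
  have h := (tendsto_integral_sawSum_sub_pow_three hα hc hM hq hiso).abs
  rw [abs_zero] at h
  exact (tendsto_zero_iff_abs_tendsto_zero _).2 (h.congr' hev)

end Conclusion

theorem mainTheorem5 (α : ℝ) (hα : Irrational α) (c : ℝ) (hc : 0 < c)
    (κ : ℝ) (hκ : κ ∈ Set.Ioo (1 / 2 : ℝ) 1)
    (k : ℕ → ℕ) (hk : StrictMono k)
    (hlim : Tendsto
      (fun n => cfDenom α (k n + 1) * distNearestInt (cfDenom α (k n) * α)) atTop (𝓝 κ)) :
    ¬ IsomorphicToInverse (specialMeasure (volume : Measure UnitAddCircle) (affineRoof c))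
      (specialFlow (circleRotation α) (affineRoof c)) := by
  intro hiso
  have h := tendsto_of_isomorphicToInverse hα hc hiso
  set d : ℕ → ℝ := fun k => distNearestInt (cfDenom α k * α) with hd
  have hd0 : ∀ k, 0 ≤ d k := fun k => abs_nonneg _
  have hq0 : ∀ k, 0 < cfDenom α k := fun k => (cfDenom_le_succ hα k).1
  have hq1 : ∀ k, cfDenom α k ≤ cfDenom α (k + 1) := fun k => (cfDenom_le_succ hα k).2
  set b : ℕ → ℝ := fun k => cfDenom α k * d k with hb
  have hb0 : ∀ k, 0 ≤ b k := fun k => mul_nonneg (hq0 k).le (hd0 k)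
  have hrel : ∀ {k}, 2 ≤ k → cfDenom α (k + 1) * d k + cfDenom α k * d (k + 1) = 1 :=
    fun hk => cfDenom_mul_add_mul hα hk
  have hbκ : ∀ k, b k ≤ cfDenom α (k + 1) * d k := fun k =>
    mul_le_mul_of_nonneg_right (hq1 k) (hd0 k)
  have hb1 : ∀ {k}, 2 ≤ k → b k ≤ 1 := fun {k} hk => by
    have := mul_nonneg (hq0 k).le (hd0 (k + 1))
    linarith [hbκ k, hrel hk]
  have hk' : Tendsto k atTop atTop := hk.tendsto_atTop
  have hmem : ∀ᶠ n in atTop, (b (k n), b (k n + 1)) ∈ Set.Icc (0 : ℝ) 1 ×ˢ Set.Icc (0 : ℝ) 1 := by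
    filter_upwards [hk'.eventually_ge_atTop 2] with n hn
    exact ⟨⟨hb0 _, hb1 hn⟩, hb0 _, hb1 (by omega)⟩
  -- Compactness gives a subsequence along which `b_k` and `b_{k+1}` both converge.
  obtain ⟨⟨x, y⟩, -, ψ, hψ, hxy⟩ :=
    (isCompact_Icc.prod isCompact_Icc).tendsto_subseq' hmem.frequently
  have hx : Tendsto (fun n => b (k (ψ n))) atTop (𝓝 x) := (continuous_fst.tendsto _).comp hxy
  have hy : Tendsto (fun n => b (k (ψ n) + 1)) atTop (𝓝 y) := (continuous_snd.tendsto _).comp hxy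
  have hkψ : Tendsto (fun n => k (ψ n)) atTop atTop := hk'.comp hψ.tendsto_atTop
  have hlimψ := hlim.comp hψ.tendsto_atTop
  have hx0 : x * (1 - x) * (2 * x - 1) = 0 :=
    tendsto_nhds_unique ((hx.mul (hx.const_sub 1)).mul ((hx.const_mul 2).sub_const 1))
      (h.comp hkψ)
  have hy0 : y * (1 - y) * (2 * y - 1) = 0 :=
    tendsto_nhds_unique ((hy.mul (hy.const_sub 1)).mul ((hy.const_mul 2).sub_const 1))
      (h.comp ((tendsto_add_atTop_nat 1).comp hkψ))
  have hxκ : x ≤ κ := le_of_tendsto_of_tendsto' hx hlimψ fun n => hbκ _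
  -- Regroup `b_k b_{k+1}` as `(q_{k+1}‖q_kα‖)(q_k‖q_{k+1}α‖)`; the two factors add up to `1`.
  have hprod : x * y = κ * (1 - κ) := by
    refine tendsto_nhds_unique (hx.mul hy) ((hlimψ.mul (hlimψ.const_sub 1)).congr' ?_)
    filter_upwards [hkψ.eventually_ge_atTop 2] with n hn
    have := hrel hn
    simp only [Function.comp_apply, hb]
    change cfDenom α (k (ψ n) + 1) * d (k (ψ n)) *
      (1 - cfDenom α (k (ψ n) + 1) * d (k (ψ n))) = _
    linear_combination (-(cfDenom α (k (ψ n) + 1) * d (k (ψ n)))) * this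
  obtain ⟨hκ1, hκ2⟩ := hκ
  have hτ : 0 < κ * (1 - κ) := mul_pos (by linarith) (by linarith)
  have hτ' : κ * (1 - κ) < 1 / 4 := by nlinarith [mul_pos (sub_pos.2 hκ1) (sub_pos.2 hκ1)]
  have hxne : x ≠ 0 := by
    rintro rfl
    rw [zero_mul] at hprod
    linarith
  have hx1 : 1 - x ≠ 0 := by linarith
  have hx2 : x = 1 / 2 := by
    rcases mul_eq_zero.1 hx0 with h | h
    · exact absurd h (mul_ne_zero hxne hx1)
    · linarith
  -- Now `y = 2κ(1 - κ)` lies strictly between `0` and `1/2`, so it is none of `0`, `1/2`, `1`.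
  rw [hx2] at hprod
  have hyne : y ≠ 0 := by linarith
  rcases mul_eq_zero.1 hy0 with h | h
  · exact mul_ne_zero hyne (by linarith) h
  · linarith
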